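/- Consider jobs that arrive in a Poisson process of rate $\lambda$, with i.i.d. sizes distributed as $S\ge 0$, where the law of $S$ is continuous (has no atoms) and $\mathbb E[S^2]<\infty$. There are $n=2$ first-come first-served servers with their own queues, each completing work at rate $\tfrac12$ (a job of size $s$ sent to a server with work $w$ has response time $2(w+s)$). Let $\rho=\lambda\,\mathbb E[S]=1-\varepsilon$. For a threshold $\theta\in\mathbb R$ the policy SITA$(\theta)$ sends a job of size $s$ to server 1 if $s<\theta$ and to server 2 if $s\ge\theta$; $\mathbb E[T_\theta]\in[0,\infty]$ is its mean response time over all jobs (the long-run average $\lim_N \frac1N\sum_{k<N}\mathbb E[T_k]$, starting from an empty system). SITA-O uses, at each $\lambda$, an optimal threshold: $\mathbb E[T_{\text{SITA-O}}]=\min_\theta\mathbb E[T_\theta]$. Let $\mathbb E[W_{\mathrm{M/G/1}}]$ be the long-run time-average mean work in the M/G/1 queue with the same arrivals and one server of speed $1$, and let $$K_{\text{SITA-O}}=\lim_{\varepsilon\downarrow0}\frac{\mathbb E[T_{\text{SITA-O}}]}{\mathbb E[W_{\mathrm{M/G/1}}]} .$$ Let $m$ be any solution of $\mathbb E[S\,\mathbf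 1(S<m)]=\tfrac12\mathbb E[S]$, and let $K_{\mathrm{CARD}}=\mathbb E[S]/\mathbb E[S\mid S\ge m]$. Theorem. For every $0<\varepsilon<\tfrac12$ the long-run averages above exist as limits in $[0,\infty]$, $\mathbb E[W_{\mathrm{M/G/1}}]=\lambda\,\mathbb E[S^2]/(2\varepsilon)$, and an optimal threshold exists. The limit $K_{\text{SITA-O}}$ exists, and $$K_{\text{SITA-O}}=\frac{2}{\mathbb E[S^2]}\Big(\sqrt{\mathbb E[S^2\mathbf 1(S<m)]\,\mathbb P(S<m)}+\sqrt{\mathbb E[S^2\mathbf 1(S\ge m)]\,\mathbb P(S\ge m)}\Big)^2\;\ge\; K_{\mathrm{CARD}}\left(1+\frac{2\sqrt{\mathbb E[S^2\mathbf 1(S<m)]\,\mathbb E[S^2\mathbf 1(S\ge m)]}}{\mathbb E[S^2]}\right).$$ In particular $K_{\text{SITA-O}}>K_{\mathrm{CARD}}$: SITA with the optimal load split is strictly suboptimal in heavy traffic. -/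

import Mathlib

open MeasureTheory Filter Topology Set
open scoped ENNReal

noncomputable section

namespace Dispatch

/-- A size- and state-aware dispatching policy for `n` servers: from the vector of amounts of work
at the servers and the size of the arriving job it computes the server the job is sent to. -/
abbrev Policy (n : ℕ) : Type := (Fin n → ℝ) → ℝ → Fin n

/-- An input sequence of the system. The entry `ω k` is the pair consisting of the size of job `k`
and of the time between the arrivals of jobs `k` and `k + 1`. -/
abbrev Input : Type := ℕ → ℝ × ℝ

/-- The law of M/G input with size distribution `μ` and arrival rate `lam`: sizes and interarrival
times are all independent, sizes have law `μ`, and interarrival times are exponential with rate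
`lam` (so that the arrivals form a Poisson process). -/
def inputLaw (μ : Measure ℝ) (lam : ℝ) : Measure Input :=
  Measure.infinitePi fun _ : ℕ => μ.prod (ProbabilityTheory.expMeasure lam)

variable {n : ℕ}

/-- The work at the servers just after a job of size `s` has arrived and met the work vector `w`. -/
def workAfter (d : Policy n) (w : Fin n → ℝ) (s : ℝ) : Fin n → ℝ :=
  fun i => w i + if d w s = i then s else 0

/-- The work at the servers after `t` units of time without arrivals. A server completes work at
rate `1 / n` as long as it has work. -/
def drain (v : Fin n → ℝ) (t : ℝ) : Fin n → ℝ :=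
  fun i => max 0 (v i - t / n)

/-- The work vector that job `k` meets on arrival; the system is empty when job `0` arrives. -/
def workAtArrival (d : Policy n) (ω : Input) : ℕ → Fin n → ℝ
  | 0 => fun _ => 0
  | k + 1 => drain (workAfter d (workAtArrival d ω k) (ω k).1) (ω k).2

/-- The response time of job `k` under first-come first-served service: the work at its server just
after its arrival has to be completed at rate `1 / n`. -/
def responseTime (d : Policy n) (ω : Input) (k : ℕ) : ℝ :=
  n * (workAtArrival d ω k (d (workAtArrival d ω k) (ω k).1) + (ω k).1)

/-- The mean of the average response time of the first `N` jobs. -/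
def avgResponseTime (μ : Measure ℝ) (lam : ℝ) (d : Policy n) (N : ℕ) : ℝ≥0∞ :=
  (∑ k ∈ Finset.range N, ∫⁻ ω, ENNReal.ofReal (responseTime d ω k) ∂(inputLaw μ lam)) / N

/-- The mean response time over all jobs, a long-run average. -/
def meanResponseTime (μ : Measure ℝ) (lam : ℝ) (d : Policy n) : ℝ≥0∞ :=
  limsup (avgResponseTime μ lam d) atTop

/-- The integral over time of the total work in the system from the arrival of job `k` to the
arrival of job `k + 1`. -/
def workArea (d : Policy n) (ω : Input) (k : ℕ) : ℝ≥0∞ :=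
  ∫⁻ t in Ioc 0 (ω k).2,
    ENNReal.ofReal (∑ i, drain (workAfter d (workAtArrival d ω k) (ω k).1) t i)

/-- The time average of the total work up to the arrival of job `N`: mean accumulated work over
mean elapsed time. -/
def avgWork (μ : Measure ℝ) (lam : ℝ) (d : Policy n) (N : ℕ) : ℝ≥0∞ :=
  (∑ k ∈ Finset.range N, ∫⁻ ω, workArea d ω k ∂(inputLaw μ lam)) /
    ∑ k ∈ Finset.range N, ∫⁻ ω, ENNReal.ofReal (ω k).2 ∂(inputLaw μ lam)

/-- The mean amount of work in the system, a long-run time average. -/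
def meanWork (μ : Measure ℝ) (lam : ℝ) (d : Policy n) : ℝ≥0∞ :=
  limsup (avgWork μ lam d) atTop

/-- The resource-pooled M/G/1 system: a single server of speed `1`. -/
def pooled : Policy 1 := fun _ _ => 0

/-- Two-server SITA with size threshold `θ`: jobs smaller than `θ` go to the first server and all
others to the second one. -/
def sita (θ : ℝ) : Policy 2 := fun _ s => if s < θ then 0 else 1

/-- The mean response time of SITA-O, which at each arrival rate uses the best threshold. -/
def sitaOResponseTime (μ : Measure ℝ) (lam : ℝ) : ℝ≥0∞ :=
  ⨅ θ : ℝ, meanResponseTime μ lam (sita θ)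

/-- The mean job size `E[S]`. -/
def meanSize (μ : Measure ℝ) : ℝ := ∫ s, s ∂μ

/-- The arrival rate `lam` for which the load `lam * E[S]` equals `1 - ε`. -/
def arrivalRate (μ : Measure ℝ) (ε : ℝ) : ℝ := (1 - ε) / meanSize μ

/-- `K` is the heavy-traffic constant of a policy (or family of policies) with mean response time
`T lam` at arrival rate `lam`: the limit, as the load increases to `1`, of the ratio of that mean
response time to the mean work in the resource-pooled M/G/1. -/
def IsHeavyTrafficConstant (μ : Measure ℝ) (T : ℝ → ℝ≥0∞) (K : ℝ≥0∞) : Prop :=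
  Tendsto (fun ε : ℝ => T (arrivalRate μ ε) / meanWork μ (arrivalRate μ ε) pooled)
    (𝓝[>] 0) (𝓝 K)

/-- `K_CARD = E[S] / E[S | S ≥ m]`. -/
def kCard (μ : Measure ℝ) (m : ℝ) : ℝ :=
  meanSize μ / ∫ s, s ∂(ProbabilityTheory.cond μ (Ici m))

end Dispatch

end

namespace Dispatch

open ProbabilityTheory

/-! ### Integrals against exponential laws -/

/-! Under SITA the two servers decouple. Instead of thinning the arrival stream, let every job visit
both servers and bring work `S 1(S ∈ A)`, possibly `0`, to the server responsible for the sizes in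
`A`. The work found there follows a Lindley recursion with exponential interarrival times, and the
work found by a job is independent of the size of that job (`lintegral_scalarWork_indicator`).

The mean of the recursion converges to the Pollaczek–Khinchine value
(`tendsto_lintegral_lindleyLaw`). No stationary law is constructed: the means increase in `k`, and
the one-step identities for the first and second moments, combined so that the probability of
emptying cancels (`lindleyLaw_balance`), determine their limit. Third moments serve to bound second
moments, and truncation removes the need for them. At load at least `1` the means diverge. Since
waits are stochastically monotone, the Cesàro averages have the same limits, and this gives the
closed form `sitaCost`.

With `x² = E[S² 1(S < θ)] P(S < θ)`, `y² = E[S² 1(S ≥ θ)] P(S ≥ θ)` and slacks `a`, `b` of the two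
servers, the ratio to the pooled work is `(2 / E[S²]) · 2ε (x² / a + y² / b) + O(ε)`, where always
`a + b = 2ε`. By Cauchy–Schwarz (`add_sq_div_add_le`) the main term is at least `(2 / E[S²]) (x +
y)²`, with equality when `a : b = x : y`. Stability puts both slacks in `(0, 2ε)`, so the load split
tends to one half, and `x`, `y` tend to their values at `m` (`tendsto_setIntegral_Iio_of_load`).
Thus the optimum tunes the split at order `ε`, while the threshold is asymptotically forced.

For the comparison, jobs above `m` carry half of the load, so there are at most as many of them as
jobs below `m`, and `K_CARD = 2 P(S ≥ m)`. Expanding the square and replacing `P(S < m)` by the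
smaller `P(S ≥ m)` gives the bound. -/

lemma lintegral_expMeasure (ν : ℝ) {f : ℝ → ℝ≥0∞} (hf : Measurable f) :
    ∫⁻ t, f t ∂(expMeasure ν) =
      ∫⁻ t in Ioi (0 : ℝ), ENNReal.ofReal (ν * Real.exp (-(ν * t))) * f t := by
  have hpdf : Measurable (exponentialPDF ν) := (measurable_exponentialPDFReal ν).ennreal_ofReal
  have h1 : ∫⁻ t, f t ∂(expMeasure ν) = ∫⁻ t, exponentialPDF ν t * f t :=
    lintegral_withDensity_eq_lintegral_mul _ hpdf hf
  rw [h1, ← lintegral_add_compl _ (measurableSet_Ici (a := (0 : ℝ))), compl_Ici]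
  have h2 : ∫⁻ t in Iio (0 : ℝ), exponentialPDF ν t * f t = 0 := by
    rw [setLIntegral_congr_fun measurableSet_Iio (g := fun _ => 0), lintegral_zero]
    intro t ht
    beta_reduce
    rw [exponentialPDF_of_neg ht, zero_mul]
  rw [h2, add_zero, setLIntegral_congr Ioi_ae_eq_Ici.symm]
  refine setLIntegral_congr_fun measurableSet_Ioi fun t ht => ?_
  rw [exponentialPDF_of_nonneg (le_of_lt ht)]

/-- The mean of `h ((v - T)⁺)` for exponential `T`, from an antiderivative of the integrand. -/
lemma lintegral_expMeasure_max_sub {ν v : ℝ} (hν : 0 < ν) (hv : 0 ≤ v) {h H : ℝ → ℝ}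
    (hc : Continuous h) (h0 : h 0 = 0) (hnn : ∀ x, 0 ≤ x → 0 ≤ h x)
    (hH : ∀ t, HasDerivAt H (ν * Real.exp (-(ν * t)) * h (v - t)) t) :
    0 ≤ H v - H 0 ∧
      ∫⁻ t, ENNReal.ofReal (h (max 0 (v - t))) ∂(expMeasure ν) = ENNReal.ofReal (H v - H 0) := by
  have hcont : Continuous fun t => ν * Real.exp (-(ν * t)) * h (v - t) := by fun_prop
  have hint := intervalIntegral.integral_eq_sub_of_hasDerivAt (fun t _ => hH t)
    (hcont.intervalIntegrable 0 v)
  refine ⟨hint ▸ intervalIntegral.integral_nonneg hv fun t ht =>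
    mul_nonneg (by positivity) (hnn _ (by linarith [ht.2])), ?_⟩
  rw [lintegral_expMeasure ν (by fun_prop), ← Ioc_union_Ioi_eq_Ioi hv,
    lintegral_union measurableSet_Ioi (Ioc_disjoint_Ioi le_rfl)]
  have h2 : ∫⁻ t in Ioi v, ENNReal.ofReal (ν * Real.exp (-(ν * t))) *
      ENNReal.ofReal (h (max 0 (v - t))) = 0 := by
    rw [setLIntegral_congr_fun measurableSet_Ioi (g := fun _ => 0), lintegral_zero]
    intro t ht
    beta_reduce
    rw [max_eq_left (sub_nonpos.2 (le_of_lt (mem_Ioi.1 ht))), h0, ENNReal.ofReal_zero, mul_zero]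
  have h3 : ∫⁻ t in Ioc 0 v, ENNReal.ofReal (ν * Real.exp (-(ν * t))) *
      ENNReal.ofReal (h (max 0 (v - t))) =
      ∫⁻ t in Ioc 0 v, ENNReal.ofReal (ν * Real.exp (-(ν * t)) * h (v - t)) := by
    refine setLIntegral_congr_fun measurableSet_Ioc fun t ht => ?_
    rw [max_eq_right (by linarith [ht.2]), ← ENNReal.ofReal_mul (by positivity)]
  rw [h2, add_zero, h3, ← ofReal_integral_eq_lintegral_ofReal]
  · rw [← intervalIntegral.integral_of_le hv, hint]
  · exact (hcont.integrableOn_Icc (a := 0) (b := v)).mono_set Ioc_subset_Icc_self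
  · filter_upwards [ae_restrict_mem measurableSet_Ioc] with t ht
    exact mul_nonneg (by positivity) (hnn _ (by linarith [ht.2]))

lemma hasDerivAt_exp_neg_mul (ν t : ℝ) :
    HasDerivAt (fun a => Real.exp (-(ν * a))) (-ν * Real.exp (-(ν * t))) t := by
  have := (((hasDerivAt_id t).const_mul ν).neg).exp
  simpa [mul_comm] using this

lemma lintegral_expMeasure_max_sub_one {ν v : ℝ} (hν : 0 < ν) (hv : 0 ≤ v) :
    0 ≤ v - 1 / ν + Real.exp (-(ν * v)) / ν ∧
      ∫⁻ t, ENNReal.ofReal (max 0 (v - t)) ∂(expMeasure ν) =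
        ENNReal.ofReal (v - 1 / ν + Real.exp (-(ν * v)) / ν) := by
  have := lintegral_expMeasure_max_sub hν hv (h := fun x => x)
    -- `exp (-νt) P(v - t)` is an antiderivative exactly when `-ν P - P' = ν h`. The polynomial `P`
    -- here and in the two lemmas below solves this equation for `h(x) = x, x², x³`.
    (H := fun t => Real.exp (-(ν * t)) * (1 / ν - (v - t))) continuous_id rfl (fun x hx => hx)
    (fun t => by
      refine HasDerivAt.congr_deriv ((hasDerivAt_exp_neg_mul ν t).mul
        (((hasDerivAt_id t).const_sub v).const_sub (1 / ν))) ?_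
      · simp
        field_simp
        ring)
  convert! this using 2 <;>
  · simp
    ring_nf

lemma lintegral_expMeasure_max_sub_sq {ν v : ℝ} (hν : 0 < ν) (hv : 0 ≤ v) :
    0 ≤ v ^ 2 - 2 / ν * v + 2 / ν ^ 2 - 2 / ν ^ 2 * Real.exp (-(ν * v)) ∧
      ∫⁻ t, ENNReal.ofReal ((max 0 (v - t)) ^ 2) ∂(expMeasure ν) =
        ENNReal.ofReal (v ^ 2 - 2 / ν * v + 2 / ν ^ 2 - 2 / ν ^ 2 * Real.exp (-(ν * v))) := by
  have := lintegral_expMeasure_max_sub hν hv (h := fun x => x ^ 2)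
    (H := fun t => Real.exp (-(ν * t)) * (-(v - t) ^ 2 + 2 / ν * (v - t) - 2 / ν ^ 2))
    (by fun_prop) (by simp) (fun x hx => by positivity)
    (fun t => by
      have h1 : HasDerivAt (fun t => v - t) (-1) t := (hasDerivAt_id t).const_sub v
      refine HasDerivAt.congr_deriv ((hasDerivAt_exp_neg_mul ν t).mul
        (((h1.pow 2).neg.add (h1.const_mul (2 / ν))).sub_const (2 / ν ^ 2))) ?_
      · simp
        field_simp
        ring)
  convert! this using 2 <;>
  · simp
    ring_nf

lemma lintegral_expMeasure_max_sub_cube {ν v : ℝ} (hν : 0 < ν) (hv : 0 ≤ v) :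
    0 ≤ v ^ 3 - 3 / ν * v ^ 2 + 6 / ν ^ 2 * v - 6 / ν ^ 3 +
        6 / ν ^ 3 * Real.exp (-(ν * v)) ∧
      ∫⁻ t, ENNReal.ofReal ((max 0 (v - t)) ^ 3) ∂(expMeasure ν) =
        ENNReal.ofReal (v ^ 3 - 3 / ν * v ^ 2 + 6 / ν ^ 2 * v - 6 / ν ^ 3 +
        6 / ν ^ 3 * Real.exp (-(ν * v))) := by
  have := lintegral_expMeasure_max_sub hν hv (h := fun x => x ^ 3)
    (H := fun t => Real.exp (-(ν * t)) *
      (-(v - t) ^ 3 + 3 / ν * (v - t) ^ 2 - 6 / ν ^ 2 * (v - t) + 6 / ν ^ 3))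
    (by fun_prop) (by simp) (fun x hx => by positivity)
    (fun t => by
      have h1 : HasDerivAt (fun t => v - t) (-1) t := (hasDerivAt_id t).const_sub v
      refine HasDerivAt.congr_deriv ((hasDerivAt_exp_neg_mul ν t).mul
        ((((h1.pow 3).neg.add ((h1.pow 2).const_mul (3 / ν))).sub
          (h1.const_mul (6 / ν ^ 2))).add_const (6 / ν ^ 3))) ?_
      · simp
        field_simp
        ring)
  convert! this using 2 <;>
  · simp
    ring_nf

lemma expMeasure_Ici {ν t : ℝ} (hν : 0 < ν) (ht : 0 ≤ t) :
    expMeasure ν (Ici t) = ENNReal.ofReal (Real.exp (-(ν * t))) := by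
  have := isProbabilityMeasure_expMeasure hν
  have hac : expMeasure ν ≪ volume := withDensity_absolutelyContinuous _ _
  have h0 : expMeasure ν {t} = 0 := hac (by simp)
  have h1 : expMeasure ν (Ici t) = expMeasure ν (Ioi t) := by
    exact (measure_congr (Ioi_ae_eq_Ici' h0)).symm
  have hc := cdf_expMeasure_eq hν t
  rw [cdf_eq_real, if_pos ht] at hc
  rw [h1, ← compl_Iic, ← ENNReal.ofReal_toReal (measure_ne_top (expMeasure ν) (Iic t)ᶜ)]
  congr 1
  change (expMeasure ν).real (Iic t)ᶜ = _
  rw [probReal_compl_eq_one_sub measurableSet_Iic, hc]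
  ring

/-- The expected integral of `F` up to an exponential time is the mean of `F` at that time, over
the rate. -/
lemma lintegral_expMeasure_setLIntegral {ν : ℝ} (hν : 0 < ν) {F : ℝ → ℝ≥0∞} (hF : Measurable F) :
    ∫⁻ a, (∫⁻ t in Ioc 0 a, F t) ∂(expMeasure ν) =
      (∫⁻ t, F t ∂(expMeasure ν)) / ENNReal.ofReal ν := by
  have := isProbabilityMeasure_expMeasure hν
  have h1 : ∀ a, ∫⁻ t in Ioc 0 a, F t = ∫⁻ t in Ioi 0, (Iic a).indicator F t := by
    intro a
    rw [lintegral_indicator measurableSet_Iic, Measure.restrict_restrict measurableSet_Iic,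
      inter_comm, Ioi_inter_Iic]
  simp_rw [h1]
  have hm : Measurable (Function.uncurry fun a t : ℝ => (Iic a).indicator F t) := by
    have : (Function.uncurry fun a t : ℝ => (Iic a).indicator F t) =
        {p : ℝ × ℝ | p.2 ≤ p.1}.indicator (fun p => F p.2) := by
      ext p
      simp [Function.uncurry, indicator]
    rw [this]
    exact (hF.comp measurable_snd).indicator (measurableSet_le measurable_snd measurable_fst)
  -- By Tonelli, time `t` is weighted by the tail probability `exp (-νt)`, which is the density at
  -- `t` divided by `ν`.
  rw [lintegral_lintegral_swap hm.aemeasurable, lintegral_expMeasure ν hF, ENNReal.div_eq_inv_mul,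
    ← lintegral_const_mul _ (by fun_prop)]
  refine setLIntegral_congr_fun measurableSet_Ioi fun t ht => ?_
  have h2 : ∀ a, (Iic a).indicator F t = (Ici t).indicator (fun _ => F t) a := by
    intro a
    simp [indicator]
  simp_rw [h2]
  rw [lintegral_indicator_const measurableSet_Ici, expMeasure_Ici hν (le_of_lt ht),
    ENNReal.ofReal_mul hν.le, ← mul_assoc, ← mul_assoc,
    ENNReal.inv_mul_cancel (by simpa using hν) ENNReal.ofReal_ne_top, one_mul, mul_comm]

/-- A multiple of an exponential variable is exponential. -/
lemma map_mul_expMeasure {ν c : ℝ} (hν : 0 < ν) (hc : 0 < c) :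
    (expMeasure ν).map (fun t => c * t) = expMeasure (ν / c) := by
  have := isProbabilityMeasure_expMeasure hν
  have := isProbabilityMeasure_expMeasure (div_pos hν hc)
  have hm : Measurable fun t : ℝ => c * t := by fun_prop
  have := Measure.isProbabilityMeasure_map (μ := expMeasure ν) hm.aemeasurable
  refine Measure.eq_of_cdf _ _ ?_
  ext x
  rw [cdf_expMeasure_eq (div_pos hν hc), cdf_eq_real, map_measureReal_apply hm measurableSet_Iic]
  have : (fun t : ℝ => c * t) ⁻¹' Iic x = Iic (x / c) := by
    ext t
    simp [le_div_iff₀' hc]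
  rw [this, ← cdf_eq_real, cdf_expMeasure_eq hν]
  have h1 : 0 ≤ x / c ↔ 0 ≤ x := by rw [le_div_iff₀ hc, zero_mul]
  have h2 : ν * (x / c) = ν / c * x := by ring
  simp only [h1, h2]

lemma lintegral_id_expMeasure {ν : ℝ} (hν : 0 < ν) :
    ∫⁻ a, ENNReal.ofReal a ∂(expMeasure ν) = (ENNReal.ofReal ν)⁻¹ := by
  have := isProbabilityMeasure_expMeasure hν
  have h := lintegral_expMeasure_setLIntegral hν (F := fun _ => 1) measurable_const
  simpa using h

end Dispatch

namespace Dispatch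

open ProbabilityTheory

/-! ### The Lindley recursion with exponential interarrival times -/

/-- The law of the `k`-th waiting time in the Lindley recursion `W ↦ (W + X - T)⁺` started at `0`,
where `X` has law `σ` and `T` is exponential with rate `ν`. -/
noncomputable def lindleyLaw (σ : Measure ℝ) (ν : ℝ) : ℕ → Measure ℝ
  | 0 => Measure.dirac 0
  | k + 1 => ((lindleyLaw σ ν k).prod (σ.prod (expMeasure ν))).map
      fun p => max 0 (p.1 + p.2.1 - p.2.2)

variable {σ : Measure ℝ} {ν : ℝ}

lemma isProbabilityMeasure_lindleyLaw [IsProbabilityMeasure σ] (hν : 0 < ν) (k : ℕ) :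
    IsProbabilityMeasure (lindleyLaw σ ν k) := by
  have := isProbabilityMeasure_expMeasure hν
  induction k with
  | zero => exact Measure.dirac.isProbabilityMeasure
  | succ k ih => exact Measure.isProbabilityMeasure_map (by fun_prop)

lemma lintegral_lindleyLaw_succ [IsProbabilityMeasure σ] (hν : 0 < ν) (k : ℕ) {f : ℝ → ℝ≥0∞}
    (hf : Measurable f) :
    ∫⁻ w, f w ∂(lindleyLaw σ ν (k + 1)) =
      ∫⁻ w, ∫⁻ x, ∫⁻ t, f (max 0 (w + x - t)) ∂(expMeasure ν) ∂σ ∂(lindleyLaw σ ν k) := by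
  have := isProbabilityMeasure_expMeasure hν
  have := isProbabilityMeasure_lindleyLaw (σ := σ) hν k
  rw [lindleyLaw, lintegral_map hf (by fun_prop),
    lintegral_prod _ (Measurable.aemeasurable (by fun_prop))]
  refine lintegral_congr fun w => ?_
  rw [lintegral_prod _ (Measurable.aemeasurable (by fun_prop))]

lemma ae_nonneg_lindleyLaw (k : ℕ) : ∀ᵐ w ∂(lindleyLaw σ ν k), 0 ≤ w := by
  cases k with
  | zero =>
    rw [lindleyLaw, ae_dirac_iff measurableSet_Ici]
  | succ k =>
    rw [lindleyLaw, ae_map_iff (Measurable.aemeasurable (by fun_prop)) measurableSet_Ici]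
    exact Eventually.of_forall fun p => le_max_left _ _

lemma monotone_lintegral_lindley_step {f : ℝ → ℝ≥0∞} (hf : Monotone f) :
    Monotone fun w => ∫⁻ x, ∫⁻ t, f (max 0 (w + x - t)) ∂(expMeasure ν) ∂σ := fun _ _ h =>
  lintegral_mono fun _ => lintegral_mono fun _ => hf (by gcongr)

/-- The waiting times are stochastically increasing. -/
lemma monotone_lintegral_lindleyLaw [IsProbabilityMeasure σ] (hν : 0 < ν) {f : ℝ → ℝ≥0∞}
    (hf : Monotone f) : Monotone fun k => ∫⁻ w, f w ∂(lindleyLaw σ ν k) := by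
  refine monotone_nat_of_le_succ fun k => ?_
  induction k generalizing f with
  | zero =>
    have := isProbabilityMeasure_lindleyLaw (σ := σ) hν 1
    calc ∫⁻ w, f w ∂(lindleyLaw σ ν 0) = f 0 := by
          rw [lindleyLaw, lintegral_dirac' _ hf.measurable]
      _ = ∫⁻ w, f 0 ∂(lindleyLaw σ ν 1) := by simp
      _ ≤ _ := lintegral_mono_ae <| (ae_nonneg_lindleyLaw 1).mono fun w hw => hf hw
  | succ k ih =>
    rw [lintegral_lindleyLaw_succ hν k hf.measurable,
      lintegral_lindleyLaw_succ hν (k + 1) hf.measurable]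
    -- The one-step mean of a monotone function is monotone, so the comparison of steps `k` and `k +
    -- 1` passes on to the next pair. This is why the induction is over all monotone `f`.
    exact ih (monotone_lintegral_lindley_step hf)

/-- Stochastically larger increments give stochastically larger waiting times. -/
lemma lintegral_lindleyLaw_le_of_stochLE {σ' : Measure ℝ} [IsProbabilityMeasure σ]
    [IsProbabilityMeasure σ'] (hν : 0 < ν)
    (hle : ∀ f : ℝ → ℝ≥0∞, Monotone f → ∫⁻ x, f x ∂σ' ≤ ∫⁻ x, f x ∂σ)
    {f : ℝ → ℝ≥0∞} (hf : Monotone f) (k : ℕ) :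
    ∫⁻ w, f w ∂(lindleyLaw σ' ν k) ≤ ∫⁻ w, f w ∂(lindleyLaw σ ν k) := by
  induction k generalizing f with
  | zero => exact le_rfl
  | succ k ih =>
    rw [lintegral_lindleyLaw_succ hν k hf.measurable, lintegral_lindleyLaw_succ hν k hf.measurable]
    refine (ih (monotone_lintegral_lindley_step hf)).trans (lintegral_mono fun w => hle _ ?_)
    exact fun _ _ h => lintegral_mono fun _ => hf (by gcongr)

/-- Means after one more step of the recursion, given the means over the interarrival time. -/
lemma integrable_lindleyLaw_succ [IsProbabilityMeasure σ] (hν : 0 < ν)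
    (hσ : ∀ᵐ x ∂σ, 0 ≤ x) (k : ℕ) {h g : ℝ → ℝ} (hh : Measurable h) (hg : Measurable g)
    (hnn : ∀ x, 0 ≤ x → 0 ≤ h x)
    (hhg : ∀ v, 0 ≤ v → 0 ≤ g v ∧ ∫⁻ t, ENNReal.ofReal (h (max 0 (v - t))) ∂(expMeasure ν) =
      ENNReal.ofReal (g v))
    (hint : Integrable (fun p : ℝ × ℝ => g (p.1 + p.2)) ((lindleyLaw σ ν k).prod σ)) :
    Integrable h (lindleyLaw σ ν (k + 1)) ∧
      ∫ w, h w ∂(lindleyLaw σ ν (k + 1)) =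
        ∫ p : ℝ × ℝ, g (p.1 + p.2) ∂((lindleyLaw σ ν k).prod σ) := by
  have := isProbabilityMeasure_lindleyLaw (σ := σ) hν k
  have h1 : ∫⁻ w, ENNReal.ofReal (h w) ∂(lindleyLaw σ ν (k + 1)) =
      ∫⁻ p : ℝ × ℝ, ENNReal.ofReal (g (p.1 + p.2)) ∂((lindleyLaw σ ν k).prod σ) := by
    rw [lintegral_lindleyLaw_succ hν k (f := fun w => ENNReal.ofReal (h w)) (by fun_prop),
      lintegral_prod _ (Measurable.aemeasurable (by fun_prop))]
    refine lintegral_congr_ae ?_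
    filter_upwards [ae_nonneg_lindleyLaw (σ := σ) (ν := ν) k] with w hw
    refine lintegral_congr_ae ?_
    filter_upwards [hσ] with x hx
    exact (hhg _ (add_nonneg hw hx)).2
  have h2 : 0 ≤ᵐ[lindleyLaw σ ν (k + 1)] h := (ae_nonneg_lindleyLaw (k + 1)).mono hnn
  have h3 : 0 ≤ᵐ[(lindleyLaw σ ν k).prod σ] fun p : ℝ × ℝ => g (p.1 + p.2) := by
    have hset : MeasurableSet {p : ℝ × ℝ | 0 ≤ g (p.1 + p.2)} :=
      measurableSet_le measurable_const (by fun_prop)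
    refine (Measure.ae_prod_iff_ae_ae hset).2 ?_
    filter_upwards [ae_nonneg_lindleyLaw (σ := σ) (ν := ν) k] with w hw
    filter_upwards [hσ] with x hx using (hhg _ (add_nonneg hw hx)).1
  refine ⟨⟨hh.aestronglyMeasurable, ?_⟩, ?_⟩
  · rw [hasFiniteIntegral_iff_ofReal h2, h1]
    exact (hasFiniteIntegral_iff_ofReal h3).1 hint.2
  · rw [integral_eq_lintegral_of_nonneg_ae h2 hh.aestronglyMeasurable, h1,
      ← integral_eq_lintegral_of_nonneg_ae h3 hint.1]

end Dispatch

namespace Dispatch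

open ProbabilityTheory

/-! ### Moments of the waiting times -/

variable {σ : Measure ℝ} {ν : ℝ}

lemma integrable_of_sq {L : Measure ℝ} [IsFiniteMeasure L]
    (h : Integrable (fun x : ℝ => x ^ 2) L) : Integrable (fun x : ℝ => x) L :=
  ((memLp_two_iff_integrable_sq measurable_id.aestronglyMeasurable).2 h).integrable one_le_two

lemma integrable_sq_of_cube {L : Measure ℝ} [IsFiniteMeasure L] (h0 : ∀ᵐ x ∂L, 0 ≤ x)
    (h : Integrable (fun x : ℝ => x ^ 3) L) : Integrable (fun x : ℝ => x ^ 2) L := by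
  refine ((integrable_const (1 : ℝ)).add h).mono' (by fun_prop) ?_
  filter_upwards [h0] with x hx
  rw [Real.norm_of_nonneg (by positivity)]
  simp only [Pi.add_apply]
  nlinarith [sq_nonneg (x - 1), mul_nonneg hx (sq_nonneg (x - 1))]

section Prod

variable {L : Measure ℝ} [IsProbabilityMeasure L] [IsProbabilityMeasure σ]

lemma integrable_integral_add (hL : Integrable (fun x : ℝ => x) L)
    (hσ : Integrable (fun x : ℝ => x) σ) :
    Integrable (fun p : ℝ × ℝ => p.1 + p.2) (L.prod σ) ∧
      ∫ p : ℝ × ℝ, p.1 + p.2 ∂(L.prod σ) = ∫ w, w ∂L + ∫ x, x ∂σ := by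
  have h1 := hL.comp_fst σ
  have h2 := hσ.comp_snd L
  refine ⟨h1.add h2, ?_⟩
  rw [integral_add h1 h2, integral_fun_fst (f := fun x : ℝ => x),
    integral_fun_snd (f := fun x : ℝ => x)]
  simp

lemma integrable_integral_add_sq (hL : Integrable (fun x : ℝ => x ^ 2) L)
    (hσ : Integrable (fun x : ℝ => x ^ 2) σ) :
    Integrable (fun p : ℝ × ℝ => (p.1 + p.2) ^ 2) (L.prod σ) ∧
      ∫ p : ℝ × ℝ, (p.1 + p.2) ^ 2 ∂(L.prod σ) =
        ∫ w, w ^ 2 ∂L + 2 * (∫ w, w ∂L) * (∫ x, x ∂σ) + ∫ x, x ^ 2 ∂σ := by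
  have h1 := hL.comp_fst σ
  have h2 := hσ.comp_snd L
  have h3 := ((integrable_of_sq hL).mul_prod (integrable_of_sq hσ)).const_mul 2
  have heq : (fun p : ℝ × ℝ => (p.1 + p.2) ^ 2) =
      fun p => p.1 ^ 2 + 2 * (p.1 * p.2) + p.2 ^ 2 := by
    ext p
    ring
  rw [heq]
  refine ⟨(h1.add h3).add h2, ?_⟩
  refine (integral_add (h1.add h3) h2).trans ?_
  rw [integral_add' h1 h3, integral_const_mul,
    integral_prod_mul (fun x : ℝ => x) (fun x : ℝ => x),
    integral_fun_fst (f := fun x : ℝ => x ^ 2), integral_fun_snd (f := fun x : ℝ => x ^ 2)]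
  simp
  ring

lemma integrable_integral_add_cube (hL0 : ∀ᵐ x ∂L, 0 ≤ x) (hσ0 : ∀ᵐ x ∂σ, 0 ≤ x)
    (hL : Integrable (fun x : ℝ => x ^ 3) L) (hσ : Integrable (fun x : ℝ => x ^ 3) σ) :
    Integrable (fun p : ℝ × ℝ => (p.1 + p.2) ^ 3) (L.prod σ) ∧
      ∫ p : ℝ × ℝ, (p.1 + p.2) ^ 3 ∂(L.prod σ) =
        ∫ w, w ^ 3 ∂L + 3 * (∫ w, w ^ 2 ∂L) * (∫ x, x ∂σ) +
          3 * (∫ w, w ∂L) * (∫ x, x ^ 2 ∂σ) + ∫ x, x ^ 3 ∂σ := by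
  have hL2 := integrable_sq_of_cube hL0 hL
  have hσ2 := integrable_sq_of_cube hσ0 hσ
  have h1 := hL.comp_fst σ
  have h2 := hσ.comp_snd L
  have h3 := (hL2.mul_prod (integrable_of_sq hσ2)).const_mul 3
  have h4 := ((integrable_of_sq hL2).mul_prod hσ2).const_mul 3
  have heq : (fun p : ℝ × ℝ => (p.1 + p.2) ^ 3) =
      fun p => p.1 ^ 3 + 3 * (p.1 ^ 2 * p.2) + 3 * (p.1 * p.2 ^ 2) + p.2 ^ 3 := by
    ext p
    ring
  rw [heq]
  refine ⟨((h1.add h3).add h4).add h2, ?_⟩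
  refine (integral_add ((h1.add h3).add h4) h2).trans ?_
  rw [integral_add' (h1.add h3) h4, integral_add' h1 h3,
    integral_const_mul, integral_const_mul,
    integral_prod_mul (fun x : ℝ => x ^ 2) (fun x : ℝ => x),
    integral_prod_mul (fun x : ℝ => x) (fun x : ℝ => x ^ 2),
    integral_fun_fst (f := fun x : ℝ => x ^ 3), integral_fun_snd (f := fun x : ℝ => x ^ 3)]
  simp
  ring

end Prod

/-- The probability that the `(k+1)`-st waiting time vanishes. -/
noncomputable def emptyProb (σ : Measure ℝ) (ν : ℝ) (k : ℕ) : ℝ :=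
  ∫ p : ℝ × ℝ, Real.exp (-(ν * (p.1 + p.2))) ∂((lindleyLaw σ ν k).prod σ)

variable [IsProbabilityMeasure σ]

lemma ae_nonneg_add (hσ : ∀ᵐ x ∂σ, 0 ≤ x) (k : ℕ) :
    ∀ᵐ p : ℝ × ℝ ∂((lindleyLaw σ ν k).prod σ), 0 ≤ p.1 + p.2 := by
  have hset : MeasurableSet {p : ℝ × ℝ | 0 ≤ p.1 + p.2} :=
    measurableSet_le measurable_const (by fun_prop)
  refine (Measure.ae_prod_iff_ae_ae hset).2 ?_
  filter_upwards [ae_nonneg_lindleyLaw (σ := σ) (ν := ν) k] with w hw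
  filter_upwards [hσ] with x hx using add_nonneg hw hx

lemma integrable_exp_neg_add (hν : 0 < ν) (hσ : ∀ᵐ x ∂σ, 0 ≤ x) (k : ℕ) :
    Integrable (fun p : ℝ × ℝ => Real.exp (-(ν * (p.1 + p.2)))) ((lindleyLaw σ ν k).prod σ) := by
  have := isProbabilityMeasure_lindleyLaw (σ := σ) hν k
  refine (integrable_const (1 : ℝ)).mono' (by fun_prop) ?_
  filter_upwards [ae_nonneg_add hσ k] with p hp
  rw [Real.norm_of_nonneg (Real.exp_pos _).le]
  exact Real.exp_le_one_iff.2 (neg_nonpos.2 (mul_nonneg hν.le hp))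

/-- Without reflection at `0` the mean would change by `E[X] - 1/ν`. Reflection adds the mean
overshoot below `0`, which by lack of memory is `1/ν` times the probability of emptying. -/
lemma mean_lindleyLaw_succ (hν : 0 < ν) (hσ : ∀ᵐ x ∂σ, 0 ≤ x)
    (hσ1 : Integrable (fun x : ℝ => x) σ) {k : ℕ}
    (hk : Integrable (fun x : ℝ => x) (lindleyLaw σ ν k)) :
    ∫ w, w ∂(lindleyLaw σ ν (k + 1)) =
        ∫ w, w ∂(lindleyLaw σ ν k) + ∫ x, x ∂σ - 1 / ν + emptyProb σ ν k / ν := by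
  have := isProbabilityMeasure_lindleyLaw (σ := σ) hν k
  obtain ⟨h1, h2⟩ := integrable_integral_add hk hσ1
  have h3 := integrable_exp_neg_add hν hσ k
  have hc := integrable_const (μ := (lindleyLaw σ ν k).prod σ) (1 / ν)
  have he := (integrable_lindleyLaw_succ hν hσ k measurable_id (by fun_prop) (fun x hx => hx)
    (fun v hv => lintegral_expMeasure_max_sub_one hν hv) ((h1.sub hc).add (h3.div_const ν))).2
  refine he.trans ((integral_add (h1.sub hc) (h3.div_const ν)).trans ?_)
  rw [integral_sub' h1 hc, h2]
  simp [emptyProb, integral_div]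

lemma integrable_sq_lindleyLaw_succ (hν : 0 < ν) (hσ : ∀ᵐ x ∂σ, 0 ≤ x)
    (hσ2 : Integrable (fun x : ℝ => x ^ 2) σ) {k : ℕ}
    (hk : Integrable (fun x : ℝ => x ^ 2) (lindleyLaw σ ν k)) :
    Integrable (fun x : ℝ => x ^ 2) (lindleyLaw σ ν (k + 1)) ∧
    ∫ w, w ^ 2 ∂(lindleyLaw σ ν (k + 1)) =
        ∫ w, w ^ 2 ∂(lindleyLaw σ ν k) + 2 * (∫ w, w ∂(lindleyLaw σ ν k)) * (∫ x, x ∂σ) +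
        ∫ x, x ^ 2 ∂σ - 2 / ν * (∫ w, w ∂(lindleyLaw σ ν k) + ∫ x, x ∂σ) + 2 / ν ^ 2 -
        2 / ν ^ 2 * emptyProb σ ν k := by
  have := isProbabilityMeasure_lindleyLaw (σ := σ) hν k
  obtain ⟨h1, h1'⟩ := integrable_integral_add (integrable_of_sq hk) (integrable_of_sq hσ2)
  obtain ⟨h2, h2'⟩ := integrable_integral_add_sq hk hσ2
  have h3 := integrable_exp_neg_add hν hσ k
  have hc := integrable_const (μ := (lindleyLaw σ ν k).prod σ) (2 / ν ^ 2)
  have h4 := h2.sub (h1.const_mul (2 / ν))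
  have h5 := h3.const_mul (2 / ν ^ 2)
  obtain ⟨hi, he⟩ := integrable_lindleyLaw_succ hν hσ k (h := fun x => x ^ 2) (by fun_prop)
    (by fun_prop) (fun x hx => by positivity)
    (fun v hv => lintegral_expMeasure_max_sub_sq hν hv) ((h4.add hc).sub h5)
  refine ⟨hi, he.trans ((integral_sub (h4.add hc) h5).trans ?_)⟩
  rw [integral_add' h4 hc, integral_sub' h2 (h1.const_mul (2 / ν)),
    integral_const_mul, integral_const_mul, h1', h2']
  simp [emptyProb]

/-- The third moment is the Lyapunov function that controls second moments uniformly in `k`. -/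
lemma integrable_cube_lindleyLaw_succ (hν : 0 < ν) (hσ : ∀ᵐ x ∂σ, 0 ≤ x)
    (hσ3 : Integrable (fun x : ℝ => x ^ 3) σ) {k : ℕ}
    (hk : Integrable (fun x : ℝ => x ^ 3) (lindleyLaw σ ν k)) :
    Integrable (fun x : ℝ => x ^ 3) (lindleyLaw σ ν (k + 1)) ∧
    ∫ w, w ^ 3 ∂(lindleyLaw σ ν (k + 1)) =
        ∫ w, w ^ 3 ∂(lindleyLaw σ ν k) + 3 * (∫ w, w ^ 2 ∂(lindleyLaw σ ν k)) * (∫ x, x ∂σ) +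
          3 * (∫ w, w ∂(lindleyLaw σ ν k)) * (∫ x, x ^ 2 ∂σ) + ∫ x, x ^ 3 ∂σ -
        3 / ν * (∫ w, w ^ 2 ∂(lindleyLaw σ ν k) +
          2 * (∫ w, w ∂(lindleyLaw σ ν k)) * (∫ x, x ∂σ) + ∫ x, x ^ 2 ∂σ) +
        6 / ν ^ 2 * (∫ w, w ∂(lindleyLaw σ ν k) + ∫ x, x ∂σ) - 6 / ν ^ 3 +
        6 / ν ^ 3 * emptyProb σ ν k := by
  have := isProbabilityMeasure_lindleyLaw (σ := σ) hν k
  have h0 := ae_nonneg_lindleyLaw (σ := σ) (ν := ν) k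
  have hk2 := integrable_sq_of_cube h0 hk
  have hσ2 := integrable_sq_of_cube hσ hσ3
  obtain ⟨h1, h1'⟩ := integrable_integral_add (integrable_of_sq hk2) (integrable_of_sq hσ2)
  obtain ⟨h2, h2'⟩ := integrable_integral_add_sq hk2 hσ2
  obtain ⟨h3, h3'⟩ := integrable_integral_add_cube h0 hσ hk hσ3
  have hc := integrable_const (μ := (lindleyLaw σ ν k).prod σ) (6 / ν ^ 3)
  have h4 := h3.sub (h2.const_mul (3 / ν))
  have h5 := h4.add (h1.const_mul (6 / ν ^ 2))
  have h6 := (integrable_exp_neg_add hν hσ k).const_mul (6 / ν ^ 3)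
  obtain ⟨hi, he⟩ := integrable_lindleyLaw_succ hν hσ k (h := fun x => x ^ 3) (by fun_prop)
    (by fun_prop) (fun x hx => by positivity)
    (fun v hv => lintegral_expMeasure_max_sub_cube hν hv) ((h5.sub hc).add h6)
  refine ⟨hi, he.trans ((integral_add (h5.sub hc) h6).trans ?_)⟩
  rw [integral_sub' h5 hc,
    integral_add' h4 (h1.const_mul (6 / ν ^ 2)), integral_sub' h3 (h2.const_mul (3 / ν)),
    integral_const_mul, integral_const_mul, integral_const_mul, h1', h2', h3']
  simp [emptyProb]

lemma integrable_sq_lindleyLaw (hν : 0 < ν) (hσ : ∀ᵐ x ∂σ, 0 ≤ x)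
    (hσ2 : Integrable (fun x : ℝ => x ^ 2) σ) (k : ℕ) :
    Integrable (fun x : ℝ => x ^ 2) (lindleyLaw σ ν k) := by
  induction k with
  | zero => exact integrable_dirac (by simp)
  | succ k ih => exact (integrable_sq_lindleyLaw_succ hν hσ hσ2 ih).1

lemma integrable_cube_lindleyLaw (hν : 0 < ν) (hσ : ∀ᵐ x ∂σ, 0 ≤ x)
    (hσ3 : Integrable (fun x : ℝ => x ^ 3) σ) (k : ℕ) :
    Integrable (fun x : ℝ => x ^ 3) (lindleyLaw σ ν k) := by
  induction k with
  | zero => exact integrable_dirac (by simp)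
  | succ k ih => exact (integrable_cube_lindleyLaw_succ hν hσ hσ3 ih).1

/-- Jensen's inequality. Bounded mean waits thus keep the probability of emptying away from `0`,
which is impossible at load at least `1`. -/
lemma exp_neg_le_emptyProb (hν : 0 < ν) (hσ : ∀ᵐ x ∂σ, 0 ≤ x)
    (hσ2 : Integrable (fun x : ℝ => x ^ 2) σ) (k : ℕ) :
    Real.exp (-(ν * (∫ w, w ∂(lindleyLaw σ ν k) + ∫ x, x ∂σ))) ≤ emptyProb σ ν k := by
  have := isProbabilityMeasure_lindleyLaw (σ := σ) hν k
  obtain ⟨h1, h1'⟩ := integrable_integral_add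
    (integrable_of_sq (integrable_sq_lindleyLaw hν hσ hσ2 k)) (integrable_of_sq hσ2)
  have := convexOn_exp.map_integral_le (μ := (lindleyLaw σ ν k).prod σ)
    (f := fun p : ℝ × ℝ => -(ν * (p.1 + p.2))) Real.continuous_exp.continuousOn isClosed_univ
    (by simp) (h1.const_mul ν).neg (integrable_exp_neg_add hν hσ k)
  rwa [integral_neg, integral_const_mul, h1'] at this

lemma emptyProb_le_one (hν : 0 < ν) (hσ : ∀ᵐ x ∂σ, 0 ≤ x) (k : ℕ) : emptyProb σ ν k ≤ 1 := by
  have := isProbabilityMeasure_lindleyLaw (σ := σ) hν k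
  refine (integral_mono_ae (integrable_exp_neg_add hν hσ k) (integrable_const 1) ?_).trans
    (by simp)
  filter_upwards [ae_nonneg_add hσ k] with p hp
  exact Real.exp_le_one_iff.2 (neg_nonpos.2 (mul_nonneg hν.le hp))

end Dispatch

namespace Dispatch

open ProbabilityTheory

/-! ### The Pollaczek–Khinchine formula -/

/-- A drift bound: a nondecreasing cost in a nonnegative system is at most its input. -/
lemma le_of_monotone_of_drift {d u : ℕ → ℝ} {C : ℝ} (hd : ∀ k, 0 ≤ d k) (hu : Monotone u)
    (h : ∀ k, d (k + 1) ≤ d k + C - u k) (k : ℕ) : u k ≤ C := by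
  by_contra! hk
  -- Once `u` exceeds `C` it stays above, so `d` falls at least linearly and eventually becomes
  -- negative.
  have h1 : ∀ n : ℕ, d (k + n) ≤ d k - n * (u k - C) := by
    intro n
    induction n with
    | zero => simp
    | succ n ih =>
      have h2 := h (k + n)
      have h3 := hu (Nat.le_add_right k n)
      rw [← add_assoc]
      push_cast
      linarith
  obtain ⟨n, hn⟩ := exists_nat_gt (d k / (u k - C))
  rw [div_lt_iff₀ (by linarith)] at hn
  linarith [h1 n, hd (k + n)]

variable {σ : Measure ℝ} {ν : ℝ}

lemma ofReal_integral_lindleyLaw {f : ℝ → ℝ} (hf : ∀ x, 0 ≤ x → 0 ≤ f x) {k : ℕ}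
    (hi : Integrable f (lindleyLaw σ ν k)) :
    ENNReal.ofReal (∫ w, f w ∂(lindleyLaw σ ν k)) =
      ∫⁻ w, ENNReal.ofReal (f w) ∂(lindleyLaw σ ν k) :=
  ofReal_integral_eq_lintegral_ofReal hi ((ae_nonneg_lindleyLaw k).mono hf)

lemma integral_lindleyLaw_nonneg {f : ℝ → ℝ} (hf : ∀ x, 0 ≤ x → 0 ≤ f x) (k : ℕ) :
    0 ≤ ∫ w, f w ∂(lindleyLaw σ ν k) :=
  integral_nonneg_of_ae ((ae_nonneg_lindleyLaw k).mono hf)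

lemma integral_map_min (M : ℝ) (n : ℕ) :
    ∫ x, x ^ n ∂(σ.map fun x => min x M) = ∫ x, (min x M) ^ n ∂σ :=
  integral_map (Measurable.aemeasurable (by fun_prop)) (by fun_prop)

lemma tendsto_integral_min_pow (hσ : ∀ᵐ x ∂σ, 0 ≤ x) {n : ℕ}
    (hi : Integrable (fun x : ℝ => x ^ n) σ) :
    Tendsto (fun M : ℕ => ∫ x, (min x (M : ℝ)) ^ n ∂σ) atTop (𝓝 (∫ x, x ^ n ∂σ)) := by
  refine tendsto_integral_of_dominated_convergence (fun x => x ^ n) (fun M => by fun_prop) hi ?_ ?_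
  · intro M
    filter_upwards [hσ] with x hx
    have h0 : 0 ≤ min x (M : ℝ) := le_min hx (Nat.cast_nonneg M)
    rw [Real.norm_of_nonneg (by positivity)]
    exact pow_le_pow_left₀ h0 (min_le_left _ _) n
  · refine Eventually.of_forall fun x => tendsto_const_nhds.congr' ?_
    filter_upwards [eventually_ge_atTop ⌈x⌉₊] with M hM
    rw [min_eq_left (Nat.ceil_le.1 hM)]

variable [IsProbabilityMeasure σ]

lemma monotone_mean_lindleyLaw (hν : 0 < ν) (hσ : ∀ᵐ x ∂σ, 0 ≤ x)
    (hσ2 : Integrable (fun x : ℝ => x ^ 2) σ) :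
    Monotone fun k => ∫ w, w ∂(lindleyLaw σ ν k) := by
  intro j k hjk
  have hi := fun k => integrable_sq_lindleyLaw hν hσ hσ2 k
  have := isProbabilityMeasure_lindleyLaw (σ := σ) hν
  have h := monotone_lintegral_lindleyLaw (σ := σ) hν (f := ENNReal.ofReal)
    (fun _ _ h => ENNReal.ofReal_le_ofReal h) hjk
  simp only at h
  rw [← ofReal_integral_lindleyLaw (fun x hx => hx) (integrable_of_sq (hi j)),
    ← ofReal_integral_lindleyLaw (fun x hx => hx) (integrable_of_sq (hi k))] at h
  exact (ENNReal.ofReal_le_ofReal_iff (integral_lindleyLaw_nonneg (fun x hx => hx) k)).1 h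

lemma monotone_sq_lindleyLaw (hν : 0 < ν) (hσ : ∀ᵐ x ∂σ, 0 ≤ x)
    (hσ2 : Integrable (fun x : ℝ => x ^ 2) σ) :
    Monotone fun k => ∫ w, w ^ 2 ∂(lindleyLaw σ ν k) := by
  intro j k hjk
  have hi := fun k => integrable_sq_lindleyLaw hν hσ hσ2 k
  -- The square is not monotone on all of `ℝ`; `(max 0 w)²` is, and agrees with it almost surely.
  have key : ∀ k, ENNReal.ofReal (∫ w, w ^ 2 ∂(lindleyLaw σ ν k)) =
      ∫⁻ w, ENNReal.ofReal ((max 0 w) ^ 2) ∂(lindleyLaw σ ν k) := by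
    intro k
    rw [ofReal_integral_lindleyLaw (fun x hx => by positivity) (hi k)]
    refine lintegral_congr_ae ((ae_nonneg_lindleyLaw k).mono fun w hw => ?_)
    simp only
    rw [max_eq_right hw]
  have h := monotone_lintegral_lindleyLaw (σ := σ) hν (f := fun w => ENNReal.ofReal ((max 0 w) ^ 2))
    (fun _ _ h => ENNReal.ofReal_le_ofReal
      (pow_le_pow_left₀ (le_max_left _ _) (max_le_max le_rfl h) 2)) hjk
  simp only at h
  rw [← key, ← key] at h
  exact (ENNReal.ofReal_le_ofReal_iff
    (integral_lindleyLaw_nonneg (fun x hx => by positivity) k)).1 h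

/-- Balance of second moments in one step of the recursion. -/
lemma lindleyLaw_balance (hν : 0 < ν) (hσ : ∀ᵐ x ∂σ, 0 ≤ x)
    (hσ2 : Integrable (fun x : ℝ => x ^ 2) σ) (k : ℕ) :
    ν / 2 * (∫ w, w ^ 2 ∂(lindleyLaw σ ν (k + 1)) - ∫ w, w ^ 2 ∂(lindleyLaw σ ν k)) =
      ν * (∫ x, x ∂σ) * (∫ w, w ∂(lindleyLaw σ ν k)) - ∫ w, w ∂(lindleyLaw σ ν (k + 1)) +
        ν * (∫ x, x ^ 2 ∂σ) / 2 := by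
  have := isProbabilityMeasure_lindleyLaw (σ := σ) hν k
  have hi := integrable_sq_lindleyLaw hν hσ hσ2 k
  rw [(integrable_sq_lindleyLaw_succ hν hσ hσ2 hi).2,
    mean_lindleyLaw_succ hν hσ (integrable_of_sq hσ2) (integrable_of_sq hi)]
  -- The factor `ν / 2` makes `emptyProb` enter both sides as `-emptyProb / ν`, so it drops out.
  field_simp
  ring

/-- The scaled second moment is the Lyapunov function: in the balance identity, monotonicity lets
the mean at `k + 1` be replaced by the smaller mean at `k`, and `le_of_monotone_of_drift` applies.
-/
lemma mean_lindleyLaw_le (hν : 0 < ν) (hσ : ∀ᵐ x ∂σ, 0 ≤ x)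
    (hσ2 : Integrable (fun x : ℝ => x ^ 2) σ) (hρ : ν * ∫ x, x ∂σ < 1) (k : ℕ) :
    (1 - ν * ∫ x, x ∂σ) * ∫ w, w ∂(lindleyLaw σ ν k) ≤ ν * (∫ x, x ^ 2 ∂σ) / 2 := by
  have hmono := monotone_mean_lindleyLaw hν hσ hσ2
  refine le_of_monotone_of_drift (d := fun k => ν / 2 * ∫ w, w ^ 2 ∂(lindleyLaw σ ν k))
    (u := fun k => (1 - ν * ∫ x, x ∂σ) * ∫ w, w ∂(lindleyLaw σ ν k))
    (fun k => mul_nonneg (by positivity) (integral_lindleyLaw_nonneg (fun x hx => by positivity) k))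
    (fun i j hij => mul_le_mul_of_nonneg_left (hmono hij) (by linarith)) (fun k => ?_) k
  have h1 := lindleyLaw_balance hν hσ hσ2 k
  have h2 := hmono (Nat.le_succ k)
  simp only [Nat.succ_eq_add_one] at h2
  linarith

lemma exists_sq_lindleyLaw_le (hν : 0 < ν) (hσ : ∀ᵐ x ∂σ, 0 ≤ x)
    (hσ3 : Integrable (fun x : ℝ => x ^ 3) σ) (hρ : ν * ∫ x, x ∂σ < 1) :
    ∃ B, ∀ k, ∫ w, w ^ 2 ∂(lindleyLaw σ ν k) ≤ B := by
  have hσ2 := integrable_sq_of_cube hσ hσ3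
  set m1 := ∫ x, x ∂σ with hm1
  set m2 := ∫ x, x ^ 2 ∂σ with hm2
  set m3 := ∫ x, x ^ 3 ∂σ with hm3
  have hm1' : 0 ≤ m1 := integral_nonneg_of_ae hσ
  have hm2' : 0 ≤ m2 := integral_nonneg fun x => by positivity
  set A := ν * m2 / 2 / (1 - ν * m1) with hA
  have ha : ∀ k, ∫ w, w ∂(lindleyLaw σ ν k) ≤ A := fun k => by
    rw [hA, le_div_iff₀ (by linarith), mul_comm]
    exact mean_lindleyLaw_le hν hσ hσ2 hρ k
  -- `C` collects the positive terms of the third-moment recursion that do not involve `E[W²]`, with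
  -- the mean replaced by its bound `A`.
  set C := 3 * A * m2 + m3 + 6 / ν ^ 2 * (A + m1) with hC
  have hpos : 0 < 3 / ν * (1 - ν * m1) := mul_pos (by positivity) (by linarith)
  refine ⟨C / (3 / ν * (1 - ν * m1)), fun k => ?_⟩
  rw [le_div_iff₀ hpos, mul_comm]
  refine le_of_monotone_of_drift (d := fun k => ∫ w, w ^ 3 ∂(lindleyLaw σ ν k))
    (u := fun k => 3 / ν * (1 - ν * m1) * ∫ w, w ^ 2 ∂(lindleyLaw σ ν k))
    (fun k => integral_lindleyLaw_nonneg (fun x hx => by positivity) k)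
    (fun i j hij => mul_le_mul_of_nonneg_left (monotone_sq_lindleyLaw hν hσ hσ2 hij) hpos.le)
    (fun k => ?_) k
  have h1 := (integrable_cube_lindleyLaw_succ hν hσ hσ3
    (integrable_cube_lindleyLaw hν hσ hσ3 k)).2
  have h2 := emptyProb_le_one hν hσ k
  have h0 : 0 ≤ ∫ w, w ∂(lindleyLaw σ ν k) := integral_lindleyLaw_nonneg (fun x hx => hx) k
  rw [h1, ← hm1, ← hm2, ← hm3]
  have h3 : 6 / ν ^ 3 * emptyProb σ ν k ≤ 6 / ν ^ 3 := mul_le_of_le_one_right (by positivity) h2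
  have h4 := mul_le_mul_of_nonneg_right (ha k) hm2'
  have h5 : 6 / ν ^ 2 * ∫ w, w ∂(lindleyLaw σ ν k) ≤ 6 / ν ^ 2 * A :=
    mul_le_mul_of_nonneg_left (ha k) (by positivity)
  have h6 : 0 ≤ 3 / ν * (2 * (∫ w, w ∂(lindleyLaw σ ν k)) * m1 + m2) := by positivity
  have h7 : 3 / ν * (1 - ν * m1) * ∫ w, w ^ 2 ∂(lindleyLaw σ ν k) =
      3 / ν * ∫ w, w ^ 2 ∂(lindleyLaw σ ν k) - 3 * (∫ w, w ^ 2 ∂(lindleyLaw σ ν k)) * m1 := by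
    field_simp
  rw [h7, hC]
  linarith

/-- Second moments are monotone and bounded, so their increments vanish, and the balance identity
becomes in the limit a linear equation for the limiting mean. -/
lemma tendsto_mean_lindleyLaw_of_cube (hν : 0 < ν) (hσ : ∀ᵐ x ∂σ, 0 ≤ x)
    (hσ3 : Integrable (fun x : ℝ => x ^ 3) σ) (hρ : ν * ∫ x, x ∂σ < 1) :
    Tendsto (fun k => ∫ w, w ∂(lindleyLaw σ ν k)) atTop
      (𝓝 (ν * (∫ x, x ^ 2 ∂σ) / 2 / (1 - ν * ∫ x, x ∂σ))) := by
  have hσ2 := integrable_sq_of_cube hσ hσ3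
  obtain ⟨B, hB⟩ := exists_sq_lindleyLaw_le hν hσ hσ3 hρ
  have hb := tendsto_atTop_ciSup (monotone_sq_lindleyLaw hν hσ hσ2)
    ⟨B, by rintro _ ⟨k, rfl⟩; exact hB k⟩
  have ha := tendsto_atTop_ciSup (monotone_mean_lindleyLaw hν hσ hσ2)
    ⟨ν * (∫ x, x ^ 2 ∂σ) / 2 / (1 - ν * ∫ x, x ∂σ), by
      rintro _ ⟨k, rfl⟩
      simp only
      rw [le_div_iff₀ (by linarith), mul_comm]
      exact mean_lindleyLaw_le hν hσ hσ2 hρ k⟩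
  set ℓ := ⨆ k, ∫ w, w ∂(lindleyLaw σ ν k)
  set β := ⨆ k, ∫ w, w ^ 2 ∂(lindleyLaw σ ν k)
  have h1 := (((tendsto_add_atTop_iff_nat 1).2 hb).sub hb).const_mul (ν / 2)
  have h2 := ((ha.const_mul (ν * ∫ x, x ∂σ)).sub
    ((tendsto_add_atTop_iff_nat 1).2 ha)).add_const (ν * (∫ x, x ^ 2 ∂σ) / 2)
  have h3 := tendsto_nhds_unique (h1.congr fun k => lindleyLaw_balance hν hσ hσ2 k) h2
  have h4 : ℓ = ν * (∫ x, x ^ 2 ∂σ) / 2 / (1 - ν * ∫ x, x ∂σ) := by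
    rw [eq_div_iff (by linarith)]
    linarith
  rwa [← h4]

/-- If the means stayed below `A`, reflection would contribute at least a fixed `η > 0` at each
step, while the unreflected drift is nonnegative; the means would then grow without bound. -/
lemma tendsto_mean_lindleyLaw_atTop (hν : 0 < ν) (hσ : ∀ᵐ x ∂σ, 0 ≤ x)
    (hσ2 : Integrable (fun x : ℝ => x ^ 2) σ) (hρ : 1 ≤ ν * ∫ x, x ∂σ) :
    Tendsto (fun k => ∫ w, w ∂(lindleyLaw σ ν k)) atTop atTop := by
  refine tendsto_atTop_atTop_of_monotone' (monotone_mean_lindleyLaw hν hσ hσ2) ?_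
  rintro ⟨A, hA⟩
  have hA' : ∀ k, ∫ w, w ∂(lindleyLaw σ ν k) ≤ A := fun k => hA ⟨k, rfl⟩
  set η := Real.exp (-(ν * (A + ∫ x, x ∂σ))) / ν with hη
  have hpos : 0 < η := by positivity
  have h1 : ∀ k, ∫ w, w ∂(lindleyLaw σ ν k) + η ≤ ∫ w, w ∂(lindleyLaw σ ν (k + 1)) := by
    intro k
    have := isProbabilityMeasure_lindleyLaw (σ := σ) hν k
    rw [mean_lindleyLaw_succ hν hσ (integrable_of_sq hσ2)
      (integrable_of_sq (integrable_sq_lindleyLaw hν hσ hσ2 k))]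
    have h2 : η ≤ emptyProb σ ν k / ν := by
      rw [hη]
      gcongr
      refine le_trans (Real.exp_le_exp.2 ?_) (exp_neg_le_emptyProb hν hσ hσ2 k)
      have := hA' k
      gcongr
    have h3 : 1 / ν ≤ ∫ x, x ∂σ := by rwa [div_le_iff₀ hν, mul_comm]
    linarith
  have h4 := le_of_monotone_of_drift (d := fun k => A - ∫ w, w ∂(lindleyLaw σ ν k)) (u := fun _ => η)
    (C := 0) (fun k => by linarith [hA' k]) monotone_const (fun k => by linarith [h1 k]) 0
  linarith

/-- The upper bound needs only two moments. For the lower bound, truncate the jobs at `M`: this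
gives stochastically smaller waits and all moments, and the truncated limits tend to the claimed
value as `M → ∞`. -/
lemma tendsto_mean_lindleyLaw (hν : 0 < ν) (hσ : ∀ᵐ x ∂σ, 0 ≤ x)
    (hσ2 : Integrable (fun x : ℝ => x ^ 2) σ) (hρ : ν * ∫ x, x ∂σ < 1) :
    Tendsto (fun k => ∫ w, w ∂(lindleyLaw σ ν k)) atTop
      (𝓝 (ν * (∫ x, x ^ 2 ∂σ) / 2 / (1 - ν * ∫ x, x ∂σ))) := by
  have hle : ∀ k, ∫ w, w ∂(lindleyLaw σ ν k) ≤
      ν * (∫ x, x ^ 2 ∂σ) / 2 / (1 - ν * ∫ x, x ∂σ) := fun k => by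
    rw [le_div_iff₀ (by linarith), mul_comm]
    exact mean_lindleyLaw_le hν hσ hσ2 hρ k
  have hbdd : BddAbove (range fun k => ∫ w, w ∂(lindleyLaw σ ν k)) :=
    ⟨_, by rintro _ ⟨k, rfl⟩; exact hle k⟩
  have ha := tendsto_atTop_ciSup (monotone_mean_lindleyLaw hν hσ hσ2) hbdd
  set ℓ := ⨆ k, ∫ w, w ∂(lindleyLaw σ ν k)
  suffices h : ν * (∫ x, x ^ 2 ∂σ) / 2 / (1 - ν * ∫ x, x ∂σ) ≤ ℓ by
    rwa [le_antisymm h (ciSup_le hle)]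
  have hσ1 := integrable_of_sq hσ2
  have hlim1 := tendsto_integral_min_pow hσ (n := 1) (by simpa using hσ1)
  have hlim2 := tendsto_integral_min_pow hσ (n := 2) hσ2
  simp only [pow_one] at hlim1
  refine le_of_tendsto (((hlim2.const_mul ν).div_const 2).div ((hlim1.const_mul ν).const_sub 1)
    (by linarith)) (Eventually.of_forall fun M => ?_)
  have hmeas : Measurable fun x : ℝ => min x (M : ℝ) := by fun_prop
  set τ := σ.map fun x => min x (M : ℝ) with hτ
  have : IsProbabilityMeasure τ := Measure.isProbabilityMeasure_map hmeas.aemeasurable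
  have hτ0 : ∀ᵐ x ∂τ, 0 ≤ x := by
    rw [hτ, ae_map_iff hmeas.aemeasurable measurableSet_Ici]
    exact hσ.mono fun x hx => le_min hx (Nat.cast_nonneg M)
  have hτM : ∀ᵐ x ∂τ, x ≤ (M : ℝ) := by
    rw [hτ, ae_map_iff hmeas.aemeasurable measurableSet_Iic]
    exact Eventually.of_forall fun x => min_le_right _ _
  have hτ3 : Integrable (fun x : ℝ => x ^ 3) τ := by
    refine (integrable_const ((M : ℝ) ^ 3)).mono' (by fun_prop) ?_
    filter_upwards [hτ0, hτM] with x hx hxM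
    rw [Real.norm_of_nonneg (by positivity)]
    exact pow_le_pow_left₀ hx hxM 3
  have hτ2 := integrable_sq_of_cube hτ0 hτ3
  have hm1 : ∫ x, min x (M : ℝ) ∂σ = ∫ x, x ∂τ := by
    simpa using (integral_map_min (σ := σ) (M : ℝ) 1).symm
  have hm2 : ∫ x, (min x (M : ℝ)) ^ 2 ∂σ = ∫ x, x ^ 2 ∂τ := (integral_map_min (M : ℝ) 2).symm
  have hm1' : ∫ x, min x (M : ℝ) ∂σ ≤ ∫ x, x ∂σ := by
    refine integral_mono_ae ?_ hσ1 (Eventually.of_forall fun x => min_le_left _ _)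
    refine hσ1.mono' (by fun_prop) (hσ.mono fun x hx => ?_)
    rw [Real.norm_of_nonneg (le_min hx (Nat.cast_nonneg M))]
    exact min_le_left _ _
  have hρτ : ν * ∫ x, x ∂τ < 1 :=
    lt_of_le_of_lt (mul_le_mul_of_nonneg_left (hm1 ▸ hm1') hν.le) hρ
  simp only [Pi.div_apply]
  rw [hm1, hm2]
  refine le_of_tendsto (tendsto_mean_lindleyLaw_of_cube hν hτ0 hτ3 hρτ)
    (Eventually.of_forall fun k => ?_)
  have := isProbabilityMeasure_lindleyLaw (σ := σ) hν k
  have := isProbabilityMeasure_lindleyLaw (σ := τ) hν k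
  refine le_trans ?_ (le_ciSup hbdd k)
  have h := lintegral_lindleyLaw_le_of_stochLE (σ := σ) (σ' := τ) hν (fun f hf => by
    rw [hτ, lintegral_map hf.measurable hmeas]
    exact lintegral_mono fun x => hf (min_le_left _ _)) (f := ENNReal.ofReal)
    (fun _ _ h => ENNReal.ofReal_le_ofReal h) k
  rw [← ofReal_integral_lindleyLaw (fun x hx => hx)
      (integrable_of_sq (integrable_sq_lindleyLaw hν hσ hσ2 k)),
    ← ofReal_integral_lindleyLaw (fun x hx => hx)
      (integrable_of_sq (integrable_sq_lindleyLaw hν hτ0 hτ2 k))] at h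
  exact (ENNReal.ofReal_le_ofReal_iff (integral_lindleyLaw_nonneg (fun x hx => hx) k)).1 h

/-- The Pollaczek–Khinchine formula, including the unstable case. -/
theorem tendsto_lintegral_lindleyLaw (hν : 0 < ν) (hσ : ∀ᵐ x ∂σ, 0 ≤ x)
    (hσ2 : Integrable (fun x : ℝ => x ^ 2) σ) :
    Tendsto (fun k => ∫⁻ w, ENNReal.ofReal w ∂(lindleyLaw σ ν k)) atTop
      (𝓝 (ENNReal.ofReal (ν * (∫ x, x ^ 2 ∂σ) / 2) / ENNReal.ofReal (1 - ν * ∫ x, x ∂σ))) := by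
  have hcongr : ∀ k, ENNReal.ofReal (∫ w, w ∂(lindleyLaw σ ν k)) =
      ∫⁻ w, ENNReal.ofReal w ∂(lindleyLaw σ ν k) := fun k => by
    have := isProbabilityMeasure_lindleyLaw (σ := σ) hν k
    exact ofReal_integral_lindleyLaw (fun x hx => hx)
      (integrable_of_sq (integrable_sq_lindleyLaw hν hσ hσ2 k))
  rcases lt_or_ge (ν * ∫ x, x ∂σ) 1 with hρ | hρ
  · rw [← ENNReal.ofReal_div_of_pos (by linarith)]
    exact (ENNReal.tendsto_ofReal (tendsto_mean_lindleyLaw hν hσ hσ2 hρ)).congr hcongr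
  -- A positive numerator is needed because `0 / 0 = 0` in `ℝ≥0∞`. A zero second moment would make
  -- the load `0`.
  · have hm2 : 0 < ∫ x, x ^ 2 ∂σ := by
      refine (integral_nonneg fun x => by positivity).lt_of_ne fun h => ?_
      have h1 := (integral_eq_zero_iff_of_nonneg (fun x => by positivity) hσ2).1 h.symm
      have h2 : ∫ x, x ∂σ = 0 := integral_eq_zero_of_ae (h1.mono fun x hx => by simpa using hx)
      rw [h2] at hρ
      linarith
    rw [ENNReal.ofReal_of_nonpos (p := 1 - _) (by linarith), ENNReal.div_zero (by
      simp only [ne_eq, ENNReal.ofReal_eq_zero, not_le]; positivity)]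
    exact (ENNReal.tendsto_ofReal_atTop.comp
      (tendsto_mean_lindleyLaw_atTop hν hσ hσ2 hρ)).congr hcongr

end Dispatch

namespace Dispatch

open ProbabilityTheory

/-! ### Work at a single server -/

/-- The work found by job `k` at a server that completes work at rate `c` and to which a job of size
`s` brings the work `x s`. -/
noncomputable def scalarWork (x : ℝ → ℝ) (c : ℝ) (ω : Input) : ℕ → ℝ
  | 0 => 0
  | k + 1 => max 0 (scalarWork x c ω k + x (ω k).1 - c * (ω k).2)

lemma measurable_scalarWork {x : ℝ → ℝ} (hx : Measurable x) (c : ℝ) (k : ℕ) :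
    Measurable fun ω => scalarWork x c ω k := by
  induction k with
  | zero => exact measurable_const
  | succ k ih =>
    simp only [scalarWork]
    fun_prop

lemma scalarWork_congr (x : ℝ → ℝ) (c : ℝ) {ω ω' : Input} {k : ℕ} (h : ∀ j < k, ω j = ω' j) :
    scalarWork x c ω k = scalarWork x c ω' k := by
  induction k with
  | zero => rfl
  | succ k ih =>
    rw [scalarWork, scalarWork, ih fun j hj => h j (by omega), h k (by omega)]

variable {μ : Measure ℝ} [IsProbabilityMeasure μ] {lam : ℝ}

lemma isProbabilityMeasure_inputLaw (hlam : 0 < lam) : IsProbabilityMeasure (inputLaw μ lam) := by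
  have := isProbabilityMeasure_expMeasure hlam
  unfold inputLaw
  infer_instance

lemma inputLaw_map_eval (hlam : 0 < lam) (k : ℕ) :
    (inputLaw μ lam).map (fun ω => ω k) = μ.prod (expMeasure lam) := by
  have := isProbabilityMeasure_expMeasure hlam
  exact Measure.infinitePi_map_eval (fun _ : ℕ => μ.prod (expMeasure lam)) k

/-- The work found by a job is independent of that job. -/
lemma indepFun_scalarWork (hlam : 0 < lam) {x : ℝ → ℝ} (hx : Measurable x) (c : ℝ) (k : ℕ) :
    IndepFun (fun ω => scalarWork x c ω k) (fun ω => ω k) (inputLaw μ lam) := by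
  have := isProbabilityMeasure_expMeasure hlam
  have hind : iIndepFun (fun (i : ℕ) (ω : Input) => ω i) (inputLaw μ lam) :=
    iIndepFun_infinitePi (P := fun _ : ℕ => μ.prod (expMeasure lam))
      (X := fun _ p => p) fun _ => measurable_id
  have h := hind.indepFun_finset (Finset.range k) {k} (by simp) fun i => measurable_pi_apply i
  -- Padding with zeros exhibits the work found by job `k` as a function of the first `k` inputs;
  -- the padding is never read, by `scalarWork_congr`.
  let ext : (Finset.range k → ℝ × ℝ) → Input := fun v j =>
    if hj : j ∈ Finset.range k then v ⟨j, hj⟩ else 0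
  have hext : Measurable ext := by
    refine measurable_pi_iff.2 fun j => ?_
    by_cases hj : j ∈ Finset.range k
    · simpa only [ext, hj, dite_true] using measurable_pi_apply _
    · simp only [ext, hj, dite_false, measurable_const]
  have hlast : Measurable fun v : ({k} : Finset ℕ) → ℝ × ℝ => v ⟨k, by simp⟩ :=
    measurable_pi_apply _
  have h2 := h.comp (φ := fun v => scalarWork x c (ext v) k)
    ((measurable_scalarWork hx c k).comp hext) hlast
  have h3 : (fun ω => scalarWork x c ω k) = fun ω : Input =>
      scalarWork x c (ext fun i => ω i) k := by
    ext ω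
    refine scalarWork_congr x c fun j hj => ?_
    simp [ext, hj]
  rw [h3]
  exact h2

/-- Measuring time in units of completed work turns speed `c` into unit speed and the arrival rate
into `lam / c`. -/
lemma map_scalarWork (hlam : 0 < lam) {x : ℝ → ℝ} (hx : Measurable x) {c : ℝ} (hc : 0 < c)
    (k : ℕ) :
    (inputLaw μ lam).map (fun ω => scalarWork x c ω k) = lindleyLaw (μ.map x) (lam / c) k := by
  have := isProbabilityMeasure_expMeasure hlam
  have := isProbabilityMeasure_inputLaw (μ := μ) hlam
  have := Measure.isProbabilityMeasure_map (μ := μ) hx.aemeasurable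
  induction k with
  | zero => simp [scalarWork, lindleyLaw, Measure.map_const]
  | succ k ih =>
    have := isProbabilityMeasure_lindleyLaw (σ := μ.map x) (div_pos hlam hc) k
    have hm := measurable_scalarWork hx c k
    have hpair := (indepFun_scalarWork (μ := μ) hlam hx c k).map_prod_eq_prod_map_map
      hm.aemeasurable (measurable_pi_apply k).aemeasurable
    rw [ih, inputLaw_map_eval hlam] at hpair
    have hT : Measurable fun t : ℝ => c * t := by fun_prop
    rw [lindleyLaw, ← map_mul_expMeasure hlam hc, Measure.map_prod_map _ _ hx hT]
    have h2 := Measure.map_prod_map (lindleyLaw (μ.map x) (lam / c) k) (μ.prod (expMeasure lam))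
      measurable_id (hx.prodMap hT)
    rw [Measure.map_id] at h2
    rw [h2, ← hpair, Measure.map_map (by fun_prop) (by fun_prop), Measure.map_map (by fun_prop)
      (by fun_prop)]
    rfl

lemma lintegral_scalarWork_pair (hlam : 0 < lam) {x : ℝ → ℝ} (hx : Measurable x) {c : ℝ}
    (hc : 0 < c) (k : ℕ) {F : ℝ → ℝ → ℝ → ℝ≥0∞}
    (hF : Measurable fun p : ℝ × ℝ × ℝ => F p.1 p.2.1 p.2.2) :
    ∫⁻ ω, F (scalarWork x c ω k) (ω k).1 (ω k).2 ∂(inputLaw μ lam) =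
      ∫⁻ w, ∫⁻ s, ∫⁻ t, F w s t ∂(expMeasure lam) ∂μ ∂(lindleyLaw (μ.map x) (lam / c) k) := by
  have := isProbabilityMeasure_expMeasure hlam
  have := isProbabilityMeasure_inputLaw (μ := μ) hlam
  have := Measure.isProbabilityMeasure_map (μ := μ) hx.aemeasurable
  have := isProbabilityMeasure_lindleyLaw (σ := μ.map x) (div_pos hlam hc) k
  have hm := measurable_scalarWork hx c k
  have hpair := (indepFun_scalarWork (μ := μ) hlam hx c k).map_prod_eq_prod_map_map
    hm.aemeasurable (measurable_pi_apply k).aemeasurable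
  rw [map_scalarWork hlam hx hc, inputLaw_map_eval hlam] at hpair
  have h1 : ∫⁻ ω, F (scalarWork x c ω k) (ω k).1 (ω k).2 ∂(inputLaw μ lam) =
      ∫⁻ p, F p.1 p.2.1 p.2.2 ∂((lindleyLaw (μ.map x) (lam / c) k).prod
        (μ.prod (expMeasure lam))) := by
    rw [← hpair, lintegral_map hF (by fun_prop)]
  rw [h1, lintegral_prod _ hF.aemeasurable]
  refine lintegral_congr fun w => ?_
  exact lintegral_prod (fun y : ℝ × ℝ => F w y.1 y.2)
    (hF.comp measurable_prodMk_left).aemeasurable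

/-! ### Cesàro means of monotone sequences -/

/-- All terms are at most `L`; for the lower bound, discard the finitely many terms before `u`
exceeds a given `c' < L`. This allows `L = ⊤`, which occurs when a server is overloaded. -/
lemma tendsto_cesaro_of_monotone {u : ℕ → ℝ≥0∞} (hu : Monotone u) {L : ℝ≥0∞}
    (hL : Tendsto u atTop (𝓝 L)) :
    Tendsto (fun N : ℕ => (∑ k ∈ Finset.range N, u k) / N) atTop (𝓝 L) := by
  have hle : ∀ k, u k ≤ L := hu.ge_of_tendsto hL
  refine tendsto_order.2 ⟨fun c hc => ?_, fun c hc => Eventually.of_forall fun N => ?_⟩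
  · obtain ⟨c', hc', hc'L⟩ := exists_between hc
    obtain ⟨k₀, hk₀⟩ := ((tendsto_order.1 hL).1 c' hc'L).exists
    have hc'top : c' ≠ ⊤ := ne_top_of_lt hc'L
    have h1 : Tendsto (fun N : ℕ => ENNReal.ofReal (1 - k₀ / N) * c') atTop (𝓝 c') := by
      have h2 : Tendsto (fun N : ℕ => (1 : ℝ) - k₀ / N) atTop (𝓝 1) := by
        simpa using (tendsto_const_div_atTop_nhds_zero_nat (k₀ : ℝ)).const_sub 1
      simpa using ENNReal.Tendsto.mul_const (ENNReal.tendsto_ofReal h2) (Or.inr hc'top) (b := c')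
    filter_upwards [(tendsto_order.1 h1).1 c hc', eventually_gt_atTop k₀] with N hN hNk
    refine hN.trans_le ?_
    have hN0 : (0 : ℝ) < N := by exact_mod_cast (by omega : 0 < N)
    have h3 : ENNReal.ofReal (1 - k₀ / N) = ((N - k₀ : ℕ) : ℝ≥0∞) / N := by
      rw [one_sub_div hN0.ne', ENNReal.ofReal_div_of_pos hN0, ENNReal.ofReal_natCast,
        ← Nat.cast_sub hNk.le, ENNReal.ofReal_natCast]
    rw [h3, ENNReal.div_eq_inv_mul, ENNReal.div_eq_inv_mul, mul_assoc]
    gcongr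
    calc ((N - k₀ : ℕ) : ℝ≥0∞) * c' = ∑ k ∈ Finset.Ico k₀ N, c' := by simp
      _ ≤ ∑ k ∈ Finset.Ico k₀ N, u k := Finset.sum_le_sum fun k hk =>
          hk₀.le.trans (hu (Finset.mem_Ico.1 hk).1)
      _ ≤ _ := Finset.sum_le_sum_of_subset fun k hk => by
          simpa using (Finset.mem_Ico.1 hk).2
  · refine lt_of_le_of_lt ?_ hc
    refine ENNReal.div_le_of_le_mul ?_
    calc ∑ k ∈ Finset.range N, u k ≤ ∑ _k ∈ Finset.range N, L := Finset.sum_le_sum fun k _ => hle k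
      _ = L * N := by simp [mul_comm]

end Dispatch

namespace Dispatch

open ProbabilityTheory

/-! ### Mean response time of SITA and mean work in the M/G/1 -/

/-- A job sent to the other server counts as an arrival with work `0`, so the recursion runs over
all arrivals. -/
lemma workAtArrival_sita_zero (θ : ℝ) (ω : Input) (k : ℕ) :
    workAtArrival (sita θ) ω k 0 = scalarWork ((Iio θ).indicator id) (1 / 2) ω k := by
  induction k with
  | zero => rfl
  | succ k ih =>
    simp only [workAtArrival, drain, workAfter, scalarWork, sita, ih, indicator, mem_Iio]
    split_ifs <;> simp_all [div_eq_inv_mul]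

lemma workAtArrival_sita_one (θ : ℝ) (ω : Input) (k : ℕ) :
    workAtArrival (sita θ) ω k 1 = scalarWork ((Ici θ).indicator id) (1 / 2) ω k := by
  induction k with
  | zero => rfl
  | succ k ih =>
    simp only [workAtArrival, drain, workAfter, scalarWork, sita, ih, indicator, mem_Ici]
    split_ifs <;> simp_all [div_eq_inv_mul, not_le_of_gt]

lemma workAtArrival_pooled (ω : Input) (k : ℕ) :
    workAtArrival pooled ω k 0 = scalarWork id 1 ω k := by
  induction k with
  | zero => rfl
  | succ k ih => simp [workAtArrival, drain, workAfter, scalarWork, pooled, ih]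

variable {μ : Measure ℝ} {lam : ℝ}

lemma ae_nonneg_of_measure_Iio (hpos : μ (Iio 0) = 0) : ∀ᵐ s ∂μ, 0 ≤ s := by
  rw [ae_iff]
  simpa [Iio] using hpos

lemma measurable_indicator_id {A : Set ℝ} (hA : MeasurableSet A) :
    Measurable (A.indicator (id : ℝ → ℝ)) := measurable_id.indicator hA

/-- Sizes outside `A` are mapped to `0`, and contribute nothing unless `0 ^ n = 1`. -/
lemma integral_map_indicator {A : Set ℝ} (hA : MeasurableSet A) {n : ℕ} (hn : n ≠ 0) :
    ∫ x, x ^ n ∂(μ.map (A.indicator id)) = ∫ s in A, s ^ n ∂μ := by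
  rw [integral_map (measurable_indicator_id hA).aemeasurable (by fun_prop),
    ← integral_indicator hA]
  refine integral_congr_ae (Eventually.of_forall fun s => ?_)
  by_cases hs : s ∈ A <;> simp [hs, hn]

variable [IsProbabilityMeasure μ]

/-- The mean wait of a job sent to the server that receives the jobs with sizes in `A`. -/
lemma lintegral_scalarWork_indicator (hlam : 0 < lam) {A : Set ℝ} (hA : MeasurableSet A) (k : ℕ) :
    ∫⁻ ω, A.indicator (fun _ => ENNReal.ofReal (2 * scalarWork (A.indicator id) (1 / 2) ω k)) (ω k).1
      ∂(inputLaw μ lam) =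
    2 * (μ A * ∫⁻ w, ENNReal.ofReal w ∂(lindleyLaw (μ.map (A.indicator id)) (2 * lam) k)) := by
  have := isProbabilityMeasure_expMeasure hlam
  have hF : Measurable fun p : ℝ × ℝ × ℝ =>
      A.indicator (fun _ => ENNReal.ofReal (2 * p.1)) p.2.1 := by
    have : (fun p : ℝ × ℝ × ℝ => A.indicator (fun _ => ENNReal.ofReal (2 * p.1)) p.2.1) =
        ((fun p : ℝ × ℝ × ℝ => p.2.1) ⁻¹' A).indicator (fun p => ENNReal.ofReal (2 * p.1)) := by
      rfl
    rw [this]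
    exact Measurable.indicator (by fun_prop) (hA.preimage (by fun_prop))
  have h := lintegral_scalarWork_pair (μ := μ) hlam (measurable_indicator_id hA)
    (c := 1 / 2) (by norm_num) k (F := fun w s _ => A.indicator (fun _ => ENNReal.ofReal (2 * w)) s) hF
  rw [h, show lam / (1 / 2) = 2 * lam by ring]
  simp only [lintegral_const, measure_univ, mul_one]
  simp_rw [lintegral_indicator_const hA, ENNReal.ofReal_mul zero_le_two, ENNReal.ofReal_ofNat]
  rw [lintegral_mul_const _ (by fun_prop), lintegral_const_mul _ (by fun_prop)]
  ring

lemma lintegral_size (hlam : 0 < lam) (hpos : μ (Iio 0) = 0)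
    (hsq : Integrable (fun s : ℝ => s ^ 2) μ) (k : ℕ) :
    ∫⁻ ω : Input, ENNReal.ofReal (2 * (ω k).1) ∂(inputLaw μ lam) =
      2 * ENNReal.ofReal (meanSize μ) := by
  have := isProbabilityMeasure_expMeasure hlam
  have h1 : ∫⁻ ω : Input, ENNReal.ofReal (2 * (ω k).1) ∂(inputLaw μ lam) =
      ∫⁻ p : ℝ × ℝ, ENNReal.ofReal (2 * p.1) ∂(μ.prod (expMeasure lam)) := by
    rw [← inputLaw_map_eval hlam k, lintegral_map (by fun_prop) (by fun_prop)]
  rw [h1, lintegral_prod _ (Measurable.aemeasurable (by fun_prop))]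
  simp only [lintegral_const, measure_univ, mul_one]
  simp_rw [ENNReal.ofReal_mul zero_le_two, ENNReal.ofReal_ofNat]
  rw [lintegral_const_mul _ (by fun_prop), meanSize,
    ofReal_integral_eq_lintegral_ofReal (integrable_of_sq hsq) (ae_nonneg_of_measure_Iio hpos)]

lemma ae_size_nonneg (hlam : 0 < lam) (hpos : μ (Iio 0) = 0) (k : ℕ) :
    ∀ᵐ ω : Input ∂(inputLaw μ lam), 0 ≤ (ω k).1 := by
  have := isProbabilityMeasure_expMeasure hlam
  have hm : Measurable fun ω : Input => ω k := measurable_pi_apply k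
  have hset : MeasurableSet {p : ℝ × ℝ | 0 ≤ p.1} := measurableSet_le measurable_const measurable_fst
  have h : ∀ᵐ p ∂(μ.prod (expMeasure lam)), 0 ≤ p.1 :=
    (Measure.ae_prod_iff_ae_ae hset).2
      ((ae_nonneg_of_measure_Iio hpos).mono fun s hs => Eventually.of_forall fun _ => hs)
  rw [← inputLaw_map_eval hlam k] at h
  exact (ae_map_iff hm.aemeasurable hset).1 h

lemma scalarWork_nonneg (x : ℝ → ℝ) (c : ℝ) (ω : Input) (k : ℕ) : 0 ≤ scalarWork x c ω k := by
  cases k with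
  | zero => exact le_rfl
  | succ k => exact le_max_left _ _

/-- For each job exactly one of the two indicator terms is active. The factors `2` come from the
speed `1/2`, and so does the rate `2 * lam`. -/
lemma lintegral_responseTime_sita (hlam : 0 < lam) (hpos : μ (Iio 0) = 0)
    (hsq : Integrable (fun s : ℝ => s ^ 2) μ) (θ : ℝ) (k : ℕ) :
    ∫⁻ ω, ENNReal.ofReal (responseTime (sita θ) ω k) ∂(inputLaw μ lam) =
      2 * (μ (Iio θ) *
        ∫⁻ w, ENNReal.ofReal w ∂(lindleyLaw (μ.map ((Iio θ).indicator id)) (2 * lam) k)) +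
      2 * (μ (Ici θ) *
        ∫⁻ w, ENNReal.ofReal w ∂(lindleyLaw (μ.map ((Ici θ).indicator id)) (2 * lam) k)) +
      2 * ENNReal.ofReal (meanSize μ) := by
  have hmeas : ∀ A : Set ℝ, MeasurableSet A → Measurable fun ω : Input => A.indicator
      (fun _ => ENNReal.ofReal (2 * scalarWork (A.indicator id) (1 / 2) ω k)) (ω k).1 := by
    intro A hA
    have hm := measurable_scalarWork (measurable_indicator_id hA) (1 / 2) k
    have : (fun ω : Input => A.indicator
        (fun _ => ENNReal.ofReal (2 * scalarWork (A.indicator id) (1 / 2) ω k)) (ω k).1) =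
        ((fun ω : Input => (ω k).1) ⁻¹' A).indicator
          (fun ω => ENNReal.ofReal (2 * scalarWork (A.indicator id) (1 / 2) ω k)) := by
      rfl
    rw [this]
    exact Measurable.indicator (by fun_prop) (hA.preimage (by fun_prop))
  rw [← lintegral_scalarWork_indicator hlam measurableSet_Iio,
    ← lintegral_scalarWork_indicator hlam measurableSet_Ici, ← lintegral_size hlam hpos hsq k,
    ← lintegral_add_left (hmeas _ measurableSet_Iio),
    ← lintegral_add_right _ (by fun_prop)]
  refine lintegral_congr_ae ?_
  filter_upwards [ae_size_nonneg hlam hpos k] with ω hω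
  rcases lt_or_ge (ω k).1 θ with h | h
  · have h' : (ω k).1 ∉ Ici θ := not_le.2 h
    have h0 := scalarWork_nonneg ((Iio θ).indicator id) (1 / 2) ω k
    rw [indicator_of_mem (mem_Iio.2 h), indicator_of_notMem h', add_zero,
      ← ENNReal.ofReal_add (by positivity) (by positivity), ← mul_add, ← workAtArrival_sita_zero]
    simp [responseTime, sita, h]
  · have h' : (ω k).1 ∉ Iio θ := not_lt.2 h
    have h0 := scalarWork_nonneg ((Ici θ).indicator id) (1 / 2) ω k
    rw [indicator_of_notMem h', indicator_of_mem (mem_Ici.2 h), zero_add,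
      ← ENNReal.ofReal_add (by positivity) (by positivity), ← mul_add, ← workAtArrival_sita_one]
    simp [responseTime, sita, not_lt.2 h]

/-- The rate-weighted stationary mean work at a server of speed `1 / 2` that receives the jobs with
sizes in `A`. -/
noncomputable def serverCost (μ : Measure ℝ) (lam : ℝ) (A : Set ℝ) : ℝ≥0∞ :=
  μ A * (ENNReal.ofReal (lam * ∫ s in A, s ^ 2 ∂μ) / ENNReal.ofReal (1 - 2 * lam * ∫ s in A, s ∂μ))

/-- The long-run mean response time of SITA with threshold `θ`. -/
noncomputable def sitaCost (μ : Measure ℝ) (lam θ : ℝ) : ℝ≥0∞ :=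
  2 * serverCost μ lam (Iio θ) + 2 * serverCost μ lam (Ici θ) + 2 * ENNReal.ofReal (meanSize μ)

lemma map_indicator_moments (hpos : μ (Iio 0) = 0) (hsq : Integrable (fun s : ℝ => s ^ 2) μ)
    {A : Set ℝ} (hA : MeasurableSet A) :
    IsProbabilityMeasure (μ.map (A.indicator id)) ∧ (∀ᵐ x ∂(μ.map (A.indicator id)), 0 ≤ x) ∧
      Integrable (fun x : ℝ => x ^ 2) (μ.map (A.indicator id)) := by
  have hm := measurable_indicator_id hA
  refine ⟨Measure.isProbabilityMeasure_map hm.aemeasurable, ?_, ?_⟩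
  · rw [ae_map_iff hm.aemeasurable measurableSet_Ici]
    filter_upwards [ae_nonneg_of_measure_Iio hpos] with s hs
    by_cases hA' : s ∈ A <;> simp [hA', hs]
  · rw [integrable_map_measure (by fun_prop) hm.aemeasurable]
    refine hsq.mono' (by fun_prop) (Eventually.of_forall fun s => ?_)
    by_cases hs : s ∈ A <;> simp [hs, sq_nonneg]

lemma tendsto_serverCost (hlam : 0 < lam) (hpos : μ (Iio 0) = 0)
    (hsq : Integrable (fun s : ℝ => s ^ 2) μ) {A : Set ℝ} (hA : MeasurableSet A) :
    Tendsto (fun k => μ A *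
      ∫⁻ w, ENNReal.ofReal w ∂(lindleyLaw (μ.map (A.indicator id)) (2 * lam) k)) atTop
      (𝓝 (serverCost μ lam A)) := by
  obtain ⟨_, h0, h2⟩ := map_indicator_moments hpos hsq hA
  have h := tendsto_lintegral_lindleyLaw (ν := 2 * lam) (by positivity) h0 h2
  have h1 : ∫ x, x ∂(μ.map (A.indicator id)) = ∫ s in A, s ∂μ := by
    simpa using integral_map_indicator (μ := μ) hA (n := 1) one_ne_zero
  rw [integral_map_indicator hA two_ne_zero, h1, show ∀ a : ℝ, 2 * lam * a / 2 = lam * a by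
    intro a; ring] at h
  exact ENNReal.Tendsto.const_mul h (Or.inr (measure_ne_top μ A))

theorem tendsto_avgResponseTime_sita (hlam : 0 < lam) (hpos : μ (Iio 0) = 0)
    (hsq : Integrable (fun s : ℝ => s ^ 2) μ) (θ : ℝ) :
    Tendsto (avgResponseTime μ lam (sita θ)) atTop (𝓝 (sitaCost μ lam θ)) := by
  refine tendsto_cesaro_of_monotone ?_ ?_
  · simp_rw [lintegral_responseTime_sita hlam hpos hsq θ]
    have hmono : ∀ A : Set ℝ, MeasurableSet A → Monotone fun k =>
        ∫⁻ w, ENNReal.ofReal w ∂(lindleyLaw (μ.map (A.indicator id)) (2 * lam) k) := by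
      intro A hA
      obtain ⟨_, -, -⟩ := map_indicator_moments hpos hsq hA
      exact monotone_lintegral_lindleyLaw (by positivity)
        fun _ _ h => ENNReal.ofReal_le_ofReal h
    intro i j hij
    have h1 := hmono _ (measurableSet_Iio (a := θ)) hij
    have h2 := hmono _ (measurableSet_Ici (a := θ)) hij
    beta_reduce at h1 h2 ⊢
    gcongr
  · simp_rw [lintegral_responseTime_sita hlam hpos hsq θ]
    exact ((ENNReal.Tendsto.const_mul (tendsto_serverCost hlam hpos hsq measurableSet_Iio)
      (Or.inr ENNReal.ofNat_ne_top)).add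
      (ENNReal.Tendsto.const_mul (tendsto_serverCost hlam hpos hsq measurableSet_Ici)
      (Or.inr ENNReal.ofNat_ne_top))).add tendsto_const_nhds

theorem meanResponseTime_sita (hlam : 0 < lam) (hpos : μ (Iio 0) = 0)
    (hsq : Integrable (fun s : ℝ => s ^ 2) μ) (θ : ℝ) :
    meanResponseTime μ lam (sita θ) = sitaCost μ lam θ :=
  (tendsto_avgResponseTime_sita hlam hpos hsq θ).limsup_eq

/-- The area up to an exponential time is, in mean, the work at that time over the rate, and this is
the work met by the next arrival: the principle that Poisson arrivals see time averages. -/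
lemma lintegral_workArea_pooled (hlam : 0 < lam) (k : ℕ) :
    ∫⁻ ω, workArea pooled ω k ∂(inputLaw μ lam) =
      (∫⁻ w, ENNReal.ofReal w ∂(lindleyLaw μ lam (k + 1))) / ENNReal.ofReal lam := by
  have := isProbabilityMeasure_expMeasure hlam
  have h1 : ∀ ω : Input, workArea pooled ω k =
      (fun w s a => ∫⁻ t in Ioc 0 a, ENNReal.ofReal (max 0 (w + s - t)))
        (scalarWork id 1 ω k) (ω k).1 (ω k).2 := by
    intro ω
    simp [workArea, drain, workAfter, workAtArrival_pooled, pooled]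
  have hF : Measurable fun p : ℝ × ℝ × ℝ =>
      ∫⁻ t in Ioc 0 p.2.2, ENNReal.ofReal (max 0 (p.1 + p.2.1 - t)) := by
    have h2 : ∀ p : ℝ × ℝ × ℝ, ∫⁻ t in Ioc 0 p.2.2, ENNReal.ofReal (max 0 (p.1 + p.2.1 - t)) =
        ∫⁻ t, {q : (ℝ × ℝ × ℝ) × ℝ | 0 < q.2 ∧ q.2 ≤ q.1.2.2}.indicator
          (fun q => ENNReal.ofReal (max 0 (q.1.1 + q.1.2.1 - q.2))) (p, t) := by
      intro p
      rw [← lintegral_indicator measurableSet_Ioc]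
      refine lintegral_congr fun t => ?_
      simp [indicator]
    simp_rw [h2]
    refine Measurable.lintegral_prod_right (Measurable.indicator (by fun_prop) ?_)
    exact (measurableSet_lt measurable_const measurable_snd).inter
      (measurableSet_le measurable_snd (by fun_prop))
  simp_rw [h1]
  rw [lintegral_scalarWork_pair hlam measurable_id one_pos k
    (F := fun w s a => ∫⁻ t in Ioc 0 a, ENNReal.ofReal (max 0 (w + s - t))) hF]
  have h2 : ∀ v : ℝ, ∫⁻ a, (∫⁻ t in Ioc 0 a, ENNReal.ofReal (max 0 (v - t))) ∂(expMeasure lam) =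
      (∫⁻ t, ENNReal.ofReal (max 0 (v - t)) ∂(expMeasure lam)) / ENNReal.ofReal lam :=
    fun v => lintegral_expMeasure_setLIntegral hlam (by fun_prop)
  simp_rw [h2]
  rw [Measure.map_id, div_one, lintegral_lindleyLaw_succ hlam k (by fun_prop)]
  simp_rw [ENNReal.div_eq_inv_mul]
  have := isProbabilityMeasure_lindleyLaw (σ := μ) hlam k
  rw [← lintegral_const_mul _ (by fun_prop)]
  refine lintegral_congr fun w => ?_
  rw [← lintegral_const_mul _ (by fun_prop)]

theorem tendsto_avgWork_pooled (hlam : 0 < lam) (hpos : μ (Iio 0) = 0)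
    (hsq : Integrable (fun s : ℝ => s ^ 2) μ) (hρ : lam * meanSize μ < 1) :
    Tendsto (avgWork μ lam pooled) atTop
      (𝓝 (ENNReal.ofReal (lam * (∫ s, s ^ 2 ∂μ) / (2 * (1 - lam * meanSize μ))))) := by
  have := isProbabilityMeasure_expMeasure hlam
  have hT : ∀ k, ∫⁻ ω : Input, ENNReal.ofReal (ω k).2 ∂(inputLaw μ lam) =
      (ENNReal.ofReal lam)⁻¹ := by
    intro k
    have h1 : ∫⁻ ω : Input, ENNReal.ofReal (ω k).2 ∂(inputLaw μ lam) =
        ∫⁻ p : ℝ × ℝ, ENNReal.ofReal p.2 ∂(μ.prod (expMeasure lam)) := by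
      rw [← inputLaw_map_eval hlam k, lintegral_map (by fun_prop) (by fun_prop)]
    rw [h1, lintegral_prod _ (Measurable.aemeasurable (by fun_prop))]
    simp [lintegral_id_expMeasure hlam]
  have hlam0 : ENNReal.ofReal lam ≠ 0 := by simpa using hlam
  have heq : ∀ N, (∑ k ∈ Finset.range N,
      ∫⁻ w, ENNReal.ofReal w ∂(lindleyLaw μ lam (k + 1))) / (N : ℝ≥0∞) =
      avgWork μ lam pooled N := by
    intro N
    rw [avgWork]
    simp_rw [lintegral_workArea_pooled hlam, hT, ENNReal.div_eq_inv_mul]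
    rw [Finset.sum_const, Finset.card_range, nsmul_eq_mul, ← Finset.mul_sum,
      ENNReal.mul_inv (Or.inr (ENNReal.inv_ne_top.2 hlam0))
        (Or.inr (ENNReal.inv_ne_zero.2 ENNReal.ofReal_ne_top)), inv_inv, mul_assoc,
      ← mul_assoc (ENNReal.ofReal lam), ENNReal.mul_inv_cancel hlam0 ENNReal.ofReal_ne_top, one_mul]
  refine Tendsto.congr heq (tendsto_cesaro_of_monotone (fun i j hij => ?_) ?_)
  · exact monotone_lintegral_lindleyLaw hlam (f := ENNReal.ofReal)
      (fun _ _ h => ENNReal.ofReal_le_ofReal h) (Nat.succ_le_succ hij)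
  · have h := tendsto_lintegral_lindleyLaw hlam (ae_nonneg_of_measure_Iio hpos) hsq
    have h1 : 0 < 1 - lam * ∫ s, s ∂μ := by
      rw [meanSize] at hρ
      linarith
    rw [← ENNReal.ofReal_div_of_pos h1, div_div] at h
    exact (tendsto_add_atTop_iff_nat 1).2 h

end Dispatch

namespace Dispatch

open ProbabilityTheory

/-! ### Dependence on the threshold -/

variable {μ : Measure ℝ} {lam : ℝ}

lemma monotone_setIntegral_Iio {f : ℝ → ℝ} (hf : Integrable f μ) (h0 : 0 ≤ᵐ[μ] f) :
    Monotone fun θ => ∫ s in Iio θ, f s ∂μ := fun _ _ h =>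
  setIntegral_mono_set hf.integrableOn (ae_restrict_of_ae h0) (Iio_subset_Iio h).eventuallyLE

lemma setIntegral_Ici_eq_sub {f : ℝ → ℝ} (hf : Integrable f μ) (θ : ℝ) :
    ∫ s in Ici θ, f s ∂μ = ∫ s, f s ∂μ - ∫ s in Iio θ, f s ∂μ := by
  rw [← integral_add_compl (measurableSet_Iio (a := θ)) hf, compl_Iio]
  ring

lemma continuous_setIntegral_Iio [NullSingletonClass μ] {f : ℝ → ℝ} (hf : Integrable f μ) :
    Continuous fun θ => ∫ s in Iio θ, f s ∂μ := by
  have h : (fun θ => ∫ s in Iio θ, f s ∂μ) =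
      fun θ => (∫ s in Iic 0, f s ∂μ) + ∫ s in (0 : ℝ)..θ, f s ∂μ := by
    ext θ
    rw [← intervalIntegral.integral_Iic_sub_Iic hf.integrableOn hf.integrableOn,
      add_sub_cancel, integral_Iic_eq_integral_Iio]
  rw [h]
  exact continuous_const.add (intervalIntegral.continuous_primitive
    (fun _ _ => hf.intervalIntegrable) 0)

lemma tendsto_setIntegral_Iio {f : ℝ → ℝ} (hf : Integrable f μ) :
    Tendsto (fun n : ℕ => ∫ s in Iio (n : ℝ), f s ∂μ) atTop (𝓝 (∫ s, f s ∂μ)) := by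
  have h := tendsto_setIntegral_of_monotone (μ := μ) (f := f) (s := fun n : ℕ => Iio (n : ℝ))
    (fun _ => measurableSet_Iio) (fun i j hij => Iio_subset_Iio (by exact_mod_cast hij))
    hf.integrableOn
  have hU : (⋃ n : ℕ, Iio (n : ℝ)) = univ := by
    refine eq_univ_of_forall fun x => ?_
    obtain ⟨n, hn⟩ := exists_nat_gt x
    exact mem_iUnion.2 ⟨n, hn⟩
  rwa [hU, setIntegral_univ] at h

lemma serverCost_of_stable [IsProbabilityMeasure μ] {A : Set ℝ} (h : 2 * lam * ∫ s in A, s ∂μ < 1) :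
    serverCost μ lam A =
      ENNReal.ofReal (lam * ((∫ s in A, s ^ 2 ∂μ) * μ.real A / (1 - 2 * lam * ∫ s in A, s ∂μ))) := by
  rw [serverCost, ← ENNReal.ofReal_div_of_pos (by linarith), ← ofReal_measureReal (μ := μ) (s := A),
    ← ENNReal.ofReal_mul measureReal_nonneg]
  congr 1
  ring

section NoAtoms

variable [NullSingletonClass μ]

lemma ae_pos_size (hpos : μ (Iio 0) = 0) : ∀ᵐ s ∂μ, 0 < s := by
  filter_upwards [ae_nonneg_of_measure_Iio hpos, (measure_eq_zero_iff_ae_notMem (μ := μ)).1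
    (measure_singleton (0 : ℝ))] with s hs hs0
  exact lt_of_le_of_ne hs fun h => hs0 (by simp [← h])

/-- A positive power of the size has zero integral only over null sets. -/
lemma measure_eq_zero_of_setIntegral_pow (hpos : μ (Iio 0) = 0) {A : Set ℝ} {n : ℕ}
    (hi : Integrable (fun s : ℝ => s ^ n) μ) (h : ∫ s in A, s ^ n ∂μ = 0) : μ A = 0 := by
  have h0 : 0 ≤ᵐ[μ.restrict A] fun s : ℝ => s ^ n :=
    ae_restrict_of_ae ((ae_nonneg_of_measure_Iio hpos).mono fun s hs => pow_nonneg hs n)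
  have h1 := (integral_eq_zero_iff_of_nonneg_ae h0 hi.integrableOn).1 h
  have h2 : ∀ᵐ s ∂(μ.restrict A), False := by
    filter_upwards [h1, ae_restrict_of_ae (ae_pos_size hpos)] with s hs hs'
    exact (pow_pos hs' n).ne' hs
  have h3 : μ.restrict A = 0 := by rwa [eventually_false_iff_eq_bot, ae_eq_bot] at h2
  exact Measure.restrict_eq_zero.1 h3

lemma setIntegral_pow_pos (hpos : μ (Iio 0) = 0) {A : Set ℝ} {n : ℕ}
    (hi : Integrable (fun s : ℝ => s ^ n) μ) (hA : μ A ≠ 0) : 0 < ∫ s in A, s ^ n ∂μ := by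
  refine lt_of_le_of_ne ?_ fun h => hA (measure_eq_zero_of_setIntegral_pow hpos hi h.symm)
  exact integral_nonneg_of_ae
    (ae_restrict_of_ae ((ae_nonneg_of_measure_Iio hpos).mono fun s hs => pow_nonneg hs n))

lemma serverCost_eq_top (hlam : 0 < lam) (hpos : μ (Iio 0) = 0)
    (hsq : Integrable (fun s : ℝ => s ^ 2) μ) {A : Set ℝ}
    (h : 1 ≤ 2 * lam * ∫ s in A, s ∂μ) : serverCost μ lam A = ⊤ := by
  have hA : μ A ≠ 0 := by
    intro h0
    rw [Measure.restrict_eq_zero.2 h0, integral_zero_measure] at h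
    norm_num at h
  have hQ := setIntegral_pow_pos hpos hsq hA
  rw [serverCost, ENNReal.ofReal_of_nonpos (p := 1 - _) (by linarith), ENNReal.div_zero (by
    simp only [ne_eq, ENNReal.ofReal_eq_zero, not_le]; positivity), ENNReal.mul_top hA]

variable [IsProbabilityMeasure μ]

lemma meanSize_pos (hpos : μ (Iio 0) = 0) (hsq : Integrable (fun s : ℝ => s ^ 2) μ) :
    0 < meanSize μ := by
  have h := setIntegral_pow_pos hpos (A := univ) (n := 1) (by simpa using integrable_of_sq hsq)
    (by simp)
  simpa [meanSize] using h

lemma integral_sq_pos (hpos : μ (Iio 0) = 0) (hsq : Integrable (fun s : ℝ => s ^ 2) μ) :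
    0 < ∫ s, s ^ 2 ∂μ := by
  have h := setIntegral_pow_pos hpos (A := univ) hsq (by simp)
  simpa using h

/-- Thresholds with the same load split send almost surely the same jobs to each server. -/
lemma Iio_ae_eq_of_load_eq (hpos : μ (Iio 0) = 0) (hsq : Integrable (fun s : ℝ => s ^ 2) μ)
    {θ θ' : ℝ} (h : ∫ s in Iio θ, s ∂μ = ∫ s in Iio θ', s ∂μ) : Iio θ =ᵐ[μ] Iio θ' := by
  wlog hle : θ ≤ θ' generalizing θ θ'
  · exact (this h.symm (le_of_not_ge hle)).symm
  have hi := integrable_of_sq hsq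
  have h1 : ∫ s in Iio θ' \ Iio θ, s ^ 1 ∂μ = 0 := by
    simp only [pow_one]
    rw [setIntegral_sdiff measurableSet_Iio hi.integrableOn (Iio_subset_Iio hle), h, sub_self]
  have h2 := measure_eq_zero_of_setIntegral_pow hpos (by simpa using hi) h1
  exact (Iio_subset_Iio hle).eventuallyLE.antisymm (ae_le_set.2 h2)

/-- If the load split converges to a nontrivial one, then so do all integrals over the sizes below
the threshold. -/
lemma tendsto_setIntegral_Iio_of_load (hpos : μ (Iio 0) = 0)
    (hsq : Integrable (fun s : ℝ => s ^ 2) μ) {m : ℝ} (hm0 : 0 < ∫ s in Iio m, s ∂μ)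
    (hm1 : ∫ s in Iio m, s ∂μ < meanSize μ) {ι : Type*} {l : Filter ι} {θ : ι → ℝ}
    (hθ : Tendsto (fun i => ∫ s in Iio (θ i), s ∂μ) l (𝓝 (∫ s in Iio m, s ∂μ)))
    {f : ℝ → ℝ} (hf : Integrable f μ) :
    Tendsto (fun i => ∫ s in Iio (θ i), f s ∂μ) l (𝓝 (∫ s in Iio m, f s ∂μ)) := by
  have hi := integrable_of_sq hsq
  have hmono := monotone_setIntegral_Iio hi (ae_nonneg_of_measure_Iio hpos)
  have hcont := continuous_setIntegral_Iio hi
  obtain ⟨b, hb⟩ := ((tendsto_order.1 (tendsto_setIntegral_Iio hi)).1 _ hm1).exists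
  have h0 : ∫ s in Iio (0 : ℝ), s ∂μ = 0 := by
    rw [Measure.restrict_eq_zero.2 hpos, integral_zero_measure]
  suffices h : Tendsto (fun t => ∫ s in Iio t, f s ∂μ)
      (comap (fun t => ∫ s in Iio t, s ∂μ) (𝓝 (∫ s in Iio m, s ∂μ)))
      (𝓝 (∫ s in Iio m, f s ∂μ)) from h.comp (tendsto_comap_iff.2 hθ)
  -- The thresholds themselves may fail to converge where the load is flat. Along each ultrafilter
  -- they are trapped in a compact interval, hence converge to some `t` with the same load as `m`,
  -- and `Iio t` and `Iio m` then agree almost surely.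
  refine tendsto_iff_ultrafilter _ _ _ |>.2 fun U hU => ?_
  have hUG : Tendsto (fun t => ∫ s in Iio t, s ∂μ) U (𝓝 (∫ s in Iio m, s ∂μ)) :=
    tendsto_iff_comap.2 hU
  have hmem : Icc (0 : ℝ) b ∈ U := by
    filter_upwards [(tendsto_order.1 hUG).1 0 hm0, (tendsto_order.1 hUG).2 _ hb] with t ht0 htb
    constructor
    · by_contra! hlt
      have := hmono hlt.le
      simp only [h0] at this
      linarith
    · by_contra! hlt
      have := hmono hlt.le
      simp only at this
      linarith
  obtain ⟨t, -, ht⟩ := isCompact_Icc.ultrafilter_le_nhds U (le_principal_iff.2 hmem)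
  have h1 := tendsto_nhds_unique hUG ((hcont.tendsto t).mono_left ht)
  have h2 : ∫ s in Iio m, f s ∂μ = ∫ s in Iio t, f s ∂μ :=
    setIntegral_congr_set (Iio_ae_eq_of_load_eq hpos hsq h1)
  rw [h2]
  exact ((continuous_setIntegral_Iio hf).tendsto t).mono_left ht

/-- Every load split is attained by some threshold. -/
lemma exists_threshold_of_load (hpos : μ (Iio 0) = 0)
    (hsq : Integrable (fun s : ℝ => s ^ 2) μ) {g : ℝ} (hg0 : 0 ≤ g) (hg1 : g < meanSize μ) :
    ∃ θ, ∫ s in Iio θ, s ∂μ = g := by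
  have hi := integrable_of_sq hsq
  obtain ⟨b, hb⟩ := ((tendsto_order.1 (tendsto_setIntegral_Iio hi)).1 _ hg1).exists
  have h0 : ∫ s in Iio (0 : ℝ), s ∂μ = 0 := by
    rw [Measure.restrict_eq_zero.2 hpos, integral_zero_measure]
  exact mem_range_of_exists_le_of_exists_ge (continuous_setIntegral_Iio hi)
    ⟨0, h0.trans_le hg0⟩ ⟨b, hb.le⟩

/-! ### Optimal thresholds -/

/-- Only `0 / 0` and `0 * ⊤` could break continuity. At a null `A θ` the denominator is `1`;
otherwise both the measure and the second moment are positive. -/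
lemma continuous_serverCost (hlam : 0 < lam) (hpos : μ (Iio 0) = 0)
    (hsq : Integrable (fun s : ℝ => s ^ 2) μ) {A : ℝ → Set ℝ}
    (h0 : Continuous fun θ => μ.real (A θ)) (h1 : Continuous fun θ => ∫ s in A θ, s ∂μ)
    (h2 : Continuous fun θ => ∫ s in A θ, s ^ 2 ∂μ) :
    Continuous fun θ => serverCost μ lam (A θ) := by
  have h0' : Continuous fun θ => μ (A θ) := by
    exact (ENNReal.continuous_ofReal.comp h0).congr fun θ => ofReal_measureReal
  refine continuous_iff_continuousAt.2 fun θ => ?_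
  have hnum : Tendsto (fun θ => ENNReal.ofReal (lam * ∫ s in A θ, s ^ 2 ∂μ)) (𝓝 θ)
      (𝓝 (ENNReal.ofReal (lam * ∫ s in A θ, s ^ 2 ∂μ))) :=
    ENNReal.tendsto_ofReal ((h2.tendsto θ).const_mul lam)
  have hden : Tendsto (fun θ => ENNReal.ofReal (1 - 2 * lam * ∫ s in A θ, s ∂μ)) (𝓝 θ)
      (𝓝 (ENNReal.ofReal (1 - 2 * lam * ∫ s in A θ, s ∂μ))) :=
    ENNReal.tendsto_ofReal (((h1.tendsto θ).const_mul (2 * lam)).const_sub 1)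
  by_cases hA : μ (A θ) = 0
  · have hz : ENNReal.ofReal (1 - 2 * lam * ∫ s in A θ, s ∂μ) = 1 := by
      rw [Measure.restrict_eq_zero.2 hA]
      simp
    refine ENNReal.Tendsto.mul (h0'.tendsto θ)
      (Or.inr (ENNReal.div_ne_top ENNReal.ofReal_ne_top (by simp [hz])))
      (ENNReal.Tendsto.div hnum (Or.inr (by simp [hz])) hden (Or.inl ENNReal.ofReal_ne_top))
      (Or.inr (measure_ne_top μ _))
  · have hQ := setIntegral_pow_pos hpos hsq hA
    refine ENNReal.Tendsto.mul (h0'.tendsto θ) (Or.inl hA)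
      (ENNReal.Tendsto.div hnum (Or.inl ?_) hden (Or.inl ENNReal.ofReal_ne_top))
      (Or.inr (measure_ne_top μ _))
    simp only [ne_eq, ENNReal.ofReal_eq_zero, not_le]
    positivity

lemma continuous_sitaCost (hlam : 0 < lam) (hpos : μ (Iio 0) = 0)
    (hsq : Integrable (fun s : ℝ => s ^ 2) μ) : Continuous fun θ => sitaCost μ lam θ := by
  have hi := integrable_of_sq hsq
  have h0 : Continuous fun θ => μ.real (Iio θ) := by
    simpa using continuous_setIntegral_Iio (μ := μ) (integrable_const (1 : ℝ))
  have h0' : Continuous fun θ => μ.real (Ici θ) := by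
    have h : ∀ θ : ℝ, μ.real (Ici θ) = 1 - μ.real (Iio θ) := fun θ => by
      rw [← compl_Iio, probReal_compl_eq_one_sub measurableSet_Iio]
    simp_rw [h]
    fun_prop
  have h1 := continuous_setIntegral_Iio hi
  have h2 := continuous_setIntegral_Iio hsq
  have hlow := continuous_serverCost hlam hpos hsq h0 h1 h2
  have hhigh : Continuous fun θ => serverCost μ lam (Ici θ) := by
    refine continuous_serverCost hlam hpos hsq h0' ?_ ?_
    · simp_rw [setIntegral_Ici_eq_sub hi]
      fun_prop
    · simp_rw [setIntegral_Ici_eq_sub hsq]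
      fun_prop
  unfold sitaCost
  exact (((ENNReal.continuous_const_mul ENNReal.ofNat_ne_top).comp hlow).add
    ((ENNReal.continuous_const_mul ENNReal.ofNat_ne_top).comp hhigh)).add continuous_const

/-- An optimal threshold exists as soon as neither server can handle all jobs. -/
lemma exists_sitaCost_le (hlam : 0 < lam) (hpos : μ (Iio 0) = 0)
    (hsq : Integrable (fun s : ℝ => s ^ 2) μ) (hρ : 1 < 2 * lam * meanSize μ) :
    ∃ θ, ∀ θ', sitaCost μ lam θ ≤ sitaCost μ lam θ' := by
  have hi := integrable_of_sq hsq
  have hmono := monotone_setIntegral_Iio hi (ae_nonneg_of_measure_Iio hpos)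
  have hlt : 1 / (2 * lam) < ∫ s, s ∂μ := by
    rwa [div_lt_iff₀ (by positivity), mul_comm]
  -- Thresholds below `0` overload the second server and those above `b` the first, so a minimum
  -- over `[0, b]` is global.
  obtain ⟨b, hb⟩ := ((tendsto_order.1 (tendsto_setIntegral_Iio hi)).1 _ hlt).exists
  obtain ⟨θ, -, hθ⟩ := isCompact_Icc.exists_isMinOn (nonempty_Icc.2 (Nat.cast_nonneg b))
    (continuous_sitaCost hlam hpos hsq).continuousOn
  refine ⟨θ, fun θ' => ?_⟩
  by_cases h : θ' ∈ Icc (0 : ℝ) b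
  · exact hθ h
  suffices h : sitaCost μ lam θ' = ⊤ from h ▸ le_top
  rcases not_and_or.1 h with h0 | h0
  · have hz : ∫ s in Iio θ', s ∂μ = 0 := by
      rw [Measure.restrict_eq_zero.2
        (measure_mono_null (Iio_subset_Iio (le_of_not_ge h0)) hpos), integral_zero_measure]
    have htop := serverCost_eq_top (A := Ici θ') hlam hpos hsq (by
      rw [setIntegral_Ici_eq_sub hi, hz, sub_zero]
      exact hρ.le)
    simp [sitaCost, htop]
  · have htop := serverCost_eq_top (A := Iio θ') hlam hpos hsq (by
      have h1 := hmono (le_of_not_ge h0)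
      simp only at h1
      have h2 := hb.trans_le h1
      rw [div_lt_iff₀ (by positivity), mul_comm] at h2
      exact h2.le)
    simp [sitaCost, htop]

lemma sitaCost_of_stable (hlam : 0 < lam) (hpos : μ (Iio 0) = 0)
    (hsq : Integrable (fun s : ℝ => s ^ 2) μ) {θ : ℝ}
    (h0 : 2 * lam * ∫ s in Iio θ, s ∂μ < 1) (h1 : 2 * lam * ∫ s in Ici θ, s ∂μ < 1) :
    sitaCost μ lam θ = ENNReal.ofReal (2 * lam *
      ((∫ s in Iio θ, s ^ 2 ∂μ) * μ.real (Iio θ) / (1 - 2 * lam * ∫ s in Iio θ, s ∂μ) +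
        (∫ s in Ici θ, s ^ 2 ∂μ) * μ.real (Ici θ) / (1 - 2 * lam * ∫ s in Ici θ, s ∂μ)) +
      2 * meanSize μ) := by
  have hQ : ∀ A : Set ℝ, 0 ≤ ∫ s in A, s ^ 2 ∂μ := fun A => integral_nonneg fun s => sq_nonneg s
  have hd0 : 0 < 1 - 2 * lam * ∫ s in Iio θ, s ∂μ := by linarith
  have hd1 : 0 < 1 - 2 * lam * ∫ s in Ici θ, s ∂μ := by linarith
  have hE := meanSize_pos hpos hsq
  have hp : ∀ A : Set ℝ, 0 ≤ μ.real A := fun A => measureReal_nonneg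
  have t0 := div_nonneg (mul_nonneg (hQ (Iio θ)) (hp (Iio θ))) hd0.le
  have t1 := div_nonneg (mul_nonneg (hQ (Ici θ)) (hp (Ici θ))) hd1.le
  rw [sitaCost, serverCost_of_stable h0, serverCost_of_stable h1,
    show (2 : ℝ≥0∞) = ENNReal.ofReal 2 by simp, ← ENNReal.ofReal_mul zero_le_two,
    ← ENNReal.ofReal_mul zero_le_two, ← ENNReal.ofReal_mul zero_le_two,
    ← ENNReal.ofReal_add (by positivity) (by positivity),
    ← ENNReal.ofReal_add (by positivity) (by positivity)]
  congr 1
  ring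

end NoAtoms

end Dispatch

namespace Dispatch

open ProbabilityTheory

/-! ### The heavy-traffic limit -/

/-- Cauchy–Schwarz, applied to slacks with `a + b = 2ε`; equality at `x : y = a : b` tells how to
divide the slack. -/
lemma add_sq_div_add_le {x y a b : ℝ} (ha : 0 < a) (hb : 0 < b) :
    (x + y) ^ 2 / (a + b) ≤ x ^ 2 / a + y ^ 2 / b := by
  have h : x ^ 2 / a + y ^ 2 / b - (x + y) ^ 2 / (a + b) =
      (x * b - y * a) ^ 2 / (a * b * (a + b)) := by
    field_simp
    ring
  have h2 : 0 ≤ (x * b - y * a) ^ 2 / (a * b * (a + b)) := by positivity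
  linarith

/-- The square root of `E[S² 1(S ∈ A)] P(S ∈ A)`. -/
noncomputable def splitRoot (μ : Measure ℝ) (A : Set ℝ) : ℝ := √((∫ s in A, s ^ 2 ∂μ) * μ.real A)

/-- The heavy-traffic constant of a SITA policy with asymptotic threshold `m`, when the load split
is tuned at second order. -/
noncomputable def sitaConst (μ : Measure ℝ) (m : ℝ) : ℝ :=
  2 / (∫ s, s ^ 2 ∂μ) * (splitRoot μ (Iio m) + splitRoot μ (Ici m)) ^ 2

variable {μ : Measure ℝ}

lemma sq_splitRoot (A : Set ℝ) : splitRoot μ A ^ 2 = (∫ s in A, s ^ 2 ∂μ) * μ.real A :=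
  Real.sq_sqrt (mul_nonneg (integral_nonneg fun s => sq_nonneg s) measureReal_nonneg)

lemma arrivalRate_pos {ε : ℝ} (hE : 0 < meanSize μ) (hε : ε ∈ Ioo (0 : ℝ) (1 / 2)) :
    0 < arrivalRate μ ε := div_pos (by linarith [hε.2]) hE

lemma arrivalRate_mul_meanSize {ε : ℝ} (hE : 0 < meanSize μ) : arrivalRate μ ε * meanSize μ = 1 - ε :=
  div_mul_cancel₀ _ hE.ne'

variable [IsProbabilityMeasure μ] [NullSingletonClass μ]

lemma tendsto_splitRoot (hpos : μ (Iio 0) = 0)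
    (hsq : Integrable (fun s : ℝ => s ^ 2) μ) {m : ℝ} (hm0 : 0 < ∫ s in Iio m, s ∂μ)
    (hm1 : ∫ s in Iio m, s ∂μ < meanSize μ) {ι : Type*} {l : Filter ι} {θ : ι → ℝ}
    (hθ : Tendsto (fun i => ∫ s in Iio (θ i), s ∂μ) l (𝓝 (∫ s in Iio m, s ∂μ))) :
    Tendsto (fun i => splitRoot μ (Iio (θ i))) l (𝓝 (splitRoot μ (Iio m))) ∧
      Tendsto (fun i => splitRoot μ (Ici (θ i))) l (𝓝 (splitRoot μ (Ici m))) := by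
  have hQ := tendsto_setIntegral_Iio_of_load hpos hsq hm0 hm1 hθ hsq
  have hp := tendsto_setIntegral_Iio_of_load hpos hsq hm0 hm1 hθ (integrable_const (1 : ℝ))
  simp only [integral_const, measureReal_restrict_apply_univ, smul_eq_mul, mul_one] at hp
  have hc : ∀ θ : ℝ, μ.real (Ici θ) = 1 - μ.real (Iio θ) := fun θ => by
    rw [← compl_Iio, probReal_compl_eq_one_sub measurableSet_Iio]
  refine ⟨(Real.continuous_sqrt.tendsto _).comp (hQ.mul hp), ?_⟩
  refine (Real.continuous_sqrt.tendsto _).comp ?_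
  simp_rw [setIntegral_Ici_eq_sub hsq, hc]
  exact (hQ.const_sub _).mul (hp.const_sub _)

section Load

variable {ε : ℝ}

lemma load_Iio_add_load_Ici (hpos : μ (Iio 0) = 0) (hsq : Integrable (fun s : ℝ => s ^ 2) μ)
    (θ : ℝ) :
    1 - 2 * arrivalRate μ ε * ∫ s in Ici θ, s ∂μ =
      2 * ε - (1 - 2 * arrivalRate μ ε * ∫ s in Iio θ, s ∂μ) := by
  have h := arrivalRate_mul_meanSize (ε := ε) (meanSize_pos hpos hsq)
  rw [setIntegral_Ici_eq_sub (integrable_of_sq hsq)]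
  rw [meanSize] at h
  linear_combination -2 * h

theorem tendsto_avgWork_arrivalRate (hpos : μ (Iio 0) = 0)
    (hsq : Integrable (fun s : ℝ => s ^ 2) μ) (hε : ε ∈ Ioo (0 : ℝ) (1 / 2)) :
    Tendsto (avgWork μ (arrivalRate μ ε) pooled) atTop
      (𝓝 (ENNReal.ofReal (arrivalRate μ ε * (∫ s, s ^ 2 ∂μ) / (2 * ε)))) := by
  have hE := meanSize_pos hpos hsq
  have hl := arrivalRate_mul_meanSize (ε := ε) hE
  have h := tendsto_avgWork_pooled (arrivalRate_pos hE hε) hpos hsq (by rw [hl]; linarith [hε.1])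
  rwa [hl, sub_sub_cancel] at h

/-- The ratio of mean response time to mean pooled work at a stabilizing threshold. -/
lemma sitaCost_div_meanWork (hpos : μ (Iio 0) = 0)
    (hsq : Integrable (fun s : ℝ => s ^ 2) μ) (hε : ε ∈ Ioo (0 : ℝ) (1 / 2)) {θ : ℝ}
    (h0 : 0 < 1 - 2 * arrivalRate μ ε * ∫ s in Iio θ, s ∂μ)
    (h1 : 1 - 2 * arrivalRate μ ε * ∫ s in Iio θ, s ∂μ < 2 * ε) :
    sitaCost μ (arrivalRate μ ε) θ / meanWork μ (arrivalRate μ ε) pooled =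
      ENNReal.ofReal (2 / (∫ s, s ^ 2 ∂μ) * (2 * ε *
        (splitRoot μ (Iio θ) ^ 2 / (1 - 2 * arrivalRate μ ε * ∫ s in Iio θ, s ∂μ) +
        splitRoot μ (Ici θ) ^ 2 / (2 * ε - (1 - 2 * arrivalRate μ ε * ∫ s in Iio θ, s ∂μ)))) +
        4 * ε * meanSize μ ^ 2 / ((1 - ε) * ∫ s, s ^ 2 ∂μ)) := by
  have hE := meanSize_pos hpos hsq
  have hM := integral_sq_pos hpos hsq
  have hlam := arrivalRate_pos hE hε
  have hsum := load_Iio_add_load_Ici (ε := ε) hpos hsq θ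
  rw [meanWork, (tendsto_avgWork_arrivalRate hpos hsq hε).limsup_eq,
    sitaCost_of_stable hlam hpos hsq (by linarith) (by linarith), hsum, ← sq_splitRoot,
    ← sq_splitRoot, ← ENNReal.ofReal_div_of_pos (div_pos (by positivity) (by linarith [hε.1]))]
  congr 1
  have hd1 : 0 < 2 * ε - (1 - 2 * arrivalRate μ ε * ∫ s in Iio θ, s ∂μ) := by linarith
  -- The queueing term `T` is a common factor and stays opaque. The other summand, of order `ε`,
  -- comes from the mean service time `2 E[S]`.
  set T := splitRoot μ (Iio θ) ^ 2 / (1 - 2 * arrivalRate μ ε * ∫ s in Iio θ, s ∂μ) +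
    splitRoot μ (Ici θ) ^ 2 / (2 * ε - (1 - 2 * arrivalRate μ ε * ∫ s in Iio θ, s ∂μ))
  have hε0 := hε.1.ne'
  have hε1 : 1 - ε ≠ 0 := by linarith [hε.2]
  rw [arrivalRate]
  field_simp
  ring

end Load

/-- The heavy-traffic constant of SITA with optimal thresholds. -/
theorem isHeavyTrafficConstant_sitaO (hpos : μ (Iio 0) = 0)
    (hsq : Integrable (fun s : ℝ => s ^ 2) μ) {m : ℝ}
    (hm : ∫ s in Iio m, s ∂μ = meanSize μ / 2) :
    IsHeavyTrafficConstant μ (sitaOResponseTime μ) (ENNReal.ofReal (sitaConst μ m)) := by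
  have hE := meanSize_pos hpos hsq
  have hM := integral_sq_pos hpos hsq
  have hm0 : 0 < ∫ s in Iio m, s ∂μ := by rw [hm]; positivity
  have hm1 : ∫ s in Iio m, s ∂μ < meanSize μ := by rw [hm]; linarith
  have hi := integrable_of_sq hsq
  have hev : ∀ᶠ ε in 𝓝[>] (0 : ℝ), ε ∈ Ioo (0 : ℝ) (1 / 2) := Ioo_mem_nhdsGT (by norm_num)
  -- This is the load integral below the threshold at which the first server has slack `c * ε`;
  -- whatever `c` is, it tends to half of `E[S]`.
  have hlim : ∀ c : ℝ, Tendsto (fun ε : ℝ => (1 - c * ε) / (2 * (1 - ε) / meanSize μ))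
      (𝓝[>] 0) (𝓝 (∫ s in Iio m, s ∂μ)) := by
    intro c
    have hcont : ContinuousAt (fun ε : ℝ => (1 - c * ε) / (2 * (1 - ε) / meanSize μ)) 0 := by
      refine ContinuousAt.div (by fun_prop) (by fun_prop) ?_
      simpa using hE.ne'
    have h := hcont.tendsto.mono_left (nhdsWithin_le_nhds (s := Ioi 0))
    convert h using 2
    rw [hm]
    simp
  have hrest : Tendsto (fun ε : ℝ => 4 * ε * meanSize μ ^ 2 / ((1 - ε) * ∫ s, s ^ 2 ∂μ))
      (𝓝[>] 0) (𝓝 0) := by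
    have hcont : ContinuousAt
        (fun ε : ℝ => 4 * ε * meanSize μ ^ 2 / ((1 - ε) * ∫ s, s ^ 2 ∂μ)) 0 := by
      refine ContinuousAt.div (by fun_prop) (by fun_prop) ?_
      simpa using hM.ne'
    simpa using hcont.tendsto.mono_left (nhdsWithin_le_nhds (s := Ioi 0))
  have hInf : ∀ ε ∈ Ioo (0 : ℝ) (1 / 2), sitaOResponseTime μ (arrivalRate μ ε) =
      ⨅ θ, sitaCost μ (arrivalRate μ ε) θ := fun ε hε =>
    iInf_congr fun θ => meanResponseTime_sita (arrivalRate_pos hE hε) hpos hsq θ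
  have hx : 0 < splitRoot μ (Iio m) := by
    have hA : μ (Iio m) ≠ 0 := fun h => by
      rw [Measure.restrict_eq_zero.2 h, integral_zero_measure] at hm0
      exact lt_irrefl _ hm0
    exact Real.sqrt_pos.2 (mul_pos (setIntegral_pow_pos hpos hsq hA)
      (ENNReal.toReal_pos hA (measure_ne_top _ _)))
  have hy : 0 < splitRoot μ (Ici m) := by
    have hA : μ (Ici m) ≠ 0 := fun h => by
      have h1 := setIntegral_Ici_eq_sub hi m
      rw [Measure.restrict_eq_zero.2 h, integral_zero_measure] at h1
      rw [meanSize] at hm1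
      linarith
    exact Real.sqrt_pos.2 (mul_pos (setIntegral_pow_pos hpos hsq hA)
      (ENNReal.toReal_pos hA (measure_ne_top _ _)))
  -- thresholds with `1 - 2 * lam * E[S 1(S < θ)] = c * ε`
  have hthr : ∀ c ∈ Ioo (0 : ℝ) 2, ∀ ε ∈ Ioo (0 : ℝ) (1 / 2), ∃ θ,
      ∫ s in Iio θ, s ∂μ = (1 - c * ε) / (2 * (1 - ε) / meanSize μ) := by
    intro c hc ε hε
    have h1 : 0 < 2 * (1 - ε) / meanSize μ := div_pos (by linarith [hε.2]) hE
    refine exists_threshold_of_load hpos hsq (div_nonneg ?_ h1.le) ?_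
    · nlinarith [mul_pos hc.1 hε.1, mul_lt_mul_of_pos_right hc.2 hε.1, hε.2]
    · rw [div_lt_iff₀ h1, mul_div_cancel₀ _ hE.ne']
      nlinarith [mul_pos hc.1 hε.1, hε.2]
  have hslack : ∀ {c ε θ : ℝ}, ε ∈ Ioo (0 : ℝ) (1 / 2) →
      ∫ s in Iio θ, s ∂μ = (1 - c * ε) / (2 * (1 - ε) / meanSize μ) →
      1 - 2 * arrivalRate μ ε * ∫ s in Iio θ, s ∂μ = c * ε := by
    intro c ε θ hε hθ
    have hε1 : 1 - ε ≠ 0 := by linarith [hε.2]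
    rw [hθ, arrivalRate]
    field_simp
    ring
  have hopt : ∀ ε ∈ Ioo (0 : ℝ) (1 / 2), ∃ θ,
      (∀ θ', sitaCost μ (arrivalRate μ ε) θ ≤ sitaCost μ (arrivalRate μ ε) θ') ∧
      0 < 1 - 2 * arrivalRate μ ε * ∫ s in Iio θ, s ∂μ ∧
      1 - 2 * arrivalRate μ ε * ∫ s in Iio θ, s ∂μ < 2 * ε := by
    intro ε hε
    have hlam := arrivalRate_pos hE hε
    have hl := arrivalRate_mul_meanSize (ε := ε) hE
    obtain ⟨θ, hθ⟩ := exists_sitaCost_le hlam hpos hsq (by rw [mul_assoc, hl]; linarith [hε.2])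
    -- With `c = 1` both servers have slack `ε`, so the optimal cost is finite and the optimal
    -- threshold must stabilize both.
    obtain ⟨θ₁, hθ₁⟩ := hthr 1 (by norm_num) ε hε
    have hs := hslack hε hθ₁
    have hsum := load_Iio_add_load_Ici (ε := ε) hpos hsq
    have hfin : sitaCost μ (arrivalRate μ ε) θ ≠ ⊤ := by
      refine ne_top_of_le_ne_top ?_ (hθ θ₁)
      rw [sitaCost_of_stable hlam hpos hsq (by linarith [hε.1])
        (by linarith [hε.1, hsum θ₁])]
      exact ENNReal.ofReal_ne_top
    refine ⟨θ, hθ, ?_, ?_⟩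
    · by_contra! h
      have htop := serverCost_eq_top (A := Iio θ) hlam hpos hsq (by linarith)
      exact hfin (by simp [sitaCost, htop])
    · by_contra! h
      have htop := serverCost_eq_top (A := Ici θ) hlam hpos hsq (by linarith [hsum θ])
      exact hfin (by simp [sitaCost, htop])
  choose! θopt hmin hst0 hst1 using hopt
  -- The equality case of Cauchy–Schwarz: the first server gets the fraction `α` of the total slack
  -- `2ε`.
  set α := splitRoot μ (Iio m) / (splitRoot μ (Iio m) + splitRoot μ (Ici m)) with hα
  have hα0 : 0 < α := by positivity
  have hα1 : α < 1 := (div_lt_one (by positivity)).2 (by linarith)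
  choose! θup hup using hthr (2 * α) ⟨by linarith, by linarith⟩
  -- both families of thresholds balance the load in the limit
  have hopt_lim : Tendsto (fun ε => ∫ s in Iio (θopt ε), s ∂μ) (𝓝[>] 0)
      (𝓝 (∫ s in Iio m, s ∂μ)) := by
    -- A first-server slack in `(0, 2ε)` squeezes the load between the cases `c = 2` and `c = 0`.
    refine tendsto_of_tendsto_of_tendsto_of_le_of_le' (hlim 2) (hlim 0) ?_ ?_
    · filter_upwards [hev] with ε hε
      rw [div_le_iff₀ (div_pos (by linarith [hε.2]) hE)]
      have h := hst1 ε hε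
      rw [arrivalRate] at h
      linarith [mul_div_assoc 2 (1 - ε) (meanSize μ), mul_comm (∫ s in Iio (θopt ε), s ∂μ)
        (2 * (1 - ε) / meanSize μ), congrArg (· * ∫ s in Iio (θopt ε), s ∂μ)
        (mul_div_assoc 2 (1 - ε) (meanSize μ))]
    · filter_upwards [hev] with ε hε
      rw [le_div_iff₀ (div_pos (by linarith [hε.2]) hE)]
      have h := hst0 ε hε
      rw [arrivalRate] at h
      linarith [mul_comm (∫ s in Iio (θopt ε), s ∂μ)
        (2 * (1 - ε) / meanSize μ), congrArg (· * ∫ s in Iio (θopt ε), s ∂μ)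
        (mul_div_assoc 2 (1 - ε) (meanSize μ))]
  have hup_lim : Tendsto (fun ε => ∫ s in Iio (θup ε), s ∂μ) (𝓝[>] 0)
      (𝓝 (∫ s in Iio m, s ∂μ)) :=
    (hlim (2 * α)).congr' (hev.mono fun ε hε => (hup ε hε).symm)
  obtain ⟨ho0, ho1⟩ := tendsto_splitRoot hpos hsq hm0 hm1 hopt_lim
  obtain ⟨hu0, hu1⟩ := tendsto_splitRoot hpos hsq hm0 hm1 hup_lim
  have hlow : Tendsto (fun ε => ENNReal.ofReal (sitaConst μ (θopt ε))) (𝓝[>] 0)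
      (𝓝 (ENNReal.ofReal (sitaConst μ m))) :=
    ENNReal.tendsto_ofReal (((ho0.add ho1).pow 2).const_mul _)
  have hupp : Tendsto (fun ε => ENNReal.ofReal (2 / (∫ s, s ^ 2 ∂μ) *
      (splitRoot μ (Iio (θup ε)) ^ 2 / α + splitRoot μ (Ici (θup ε)) ^ 2 / (1 - α)) +
        4 * ε * meanSize μ ^ 2 / ((1 - ε) * ∫ s, s ^ 2 ∂μ))) (𝓝[>] 0)
      (𝓝 (ENNReal.ofReal (sitaConst μ m))) := by
    have hval : sitaConst μ m = 2 / (∫ s, s ^ 2 ∂μ) *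
        (splitRoot μ (Iio m) ^ 2 / α + splitRoot μ (Ici m) ^ 2 / (1 - α)) + 0 := by
      have h1 : 1 - α = splitRoot μ (Ici m) / (splitRoot μ (Iio m) + splitRoot μ (Ici m)) := by
        rw [hα]
        field_simp
        ring
      rw [h1, hα, sitaConst]
      field_simp
      ring
    rw [hval]
    exact ENNReal.tendsto_ofReal (((((hu0.pow 2).div_const α).add
      ((hu1.pow 2).div_const (1 - α))).const_mul _).add hrest)
  refine tendsto_of_tendsto_of_tendsto_of_le_of_le' hlow hupp ?_ ?_
  · filter_upwards [hev] with ε hε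
    have heq : sitaOResponseTime μ (arrivalRate μ ε) = sitaCost μ (arrivalRate μ ε) (θopt ε) := by
      rw [hInf ε hε]
      exact le_antisymm (iInf_le _ _) (le_iInf (hmin ε hε))
    rw [heq, sitaCost_div_meanWork hpos hsq hε (hst0 ε hε) (hst1 ε hε)]
    refine ENNReal.ofReal_le_ofReal ?_
    have h1 := add_sq_div_add_le (x := splitRoot μ (Iio (θopt ε)))
      (y := splitRoot μ (Ici (θopt ε))) (hst0 ε hε) (sub_pos.2 (hst1 ε hε))
    rw [add_sub_cancel, div_le_iff₀ (by linarith [hε.1]), mul_comm] at h1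
    have h2 : 0 ≤ 4 * ε * meanSize μ ^ 2 / ((1 - ε) * ∫ s, s ^ 2 ∂μ) :=
      div_nonneg (mul_nonneg (by linarith [hε.1]) (sq_nonneg _))
        (mul_nonneg (by linarith [hε.2]) hM.le)
    have h3 := mul_le_mul_of_nonneg_left h1 (div_nonneg zero_le_two hM.le)
    rw [sitaConst]
    linarith
  · filter_upwards [hev] with ε hε
    have hs := hslack hε (hup ε hε)
    have hε0 := hε.1
    have h1 := sitaCost_div_meanWork hpos hsq hε (θ := θup ε) (by rw [hs]; positivity)
      (by rw [hs]; nlinarith)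
    rw [hs] at h1
    have h2 : 2 * ε * (splitRoot μ (Iio (θup ε)) ^ 2 / (2 * α * ε) +
        splitRoot μ (Ici (θup ε)) ^ 2 / (2 * ε - 2 * α * ε)) =
        splitRoot μ (Iio (θup ε)) ^ 2 / α + splitRoot μ (Ici (θup ε)) ^ 2 / (1 - α) := by
      have : 1 - α ≠ 0 := by linarith
      rw [show 2 * ε - 2 * α * ε = 2 * ε * (1 - α) by ring]
      field_simp
    rw [h2] at h1
    rw [← h1, hInf ε hε]
    exact ENNReal.div_le_div_right (iInf_le _ _) _

/-! ### Comparison with CARD, and the main theorem -/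

lemma kCard_eq (hpos : μ (Iio 0) = 0) (hsq : Integrable (fun s : ℝ => s ^ 2) μ) {m : ℝ}
    (hm : ∫ s in Iio m, s ∂μ = meanSize μ / 2) : kCard μ m = 2 * μ.real (Ici m) := by
  have hE := meanSize_pos hpos hsq
  have h1 : ∫ s in Ici m, s ∂μ = meanSize μ / 2 := by
    rw [setIntegral_Ici_eq_sub (integrable_of_sq hsq), hm, meanSize]
    ring
  rw [kCard, ProbabilityTheory.cond, integral_smul_measure, h1, ENNReal.toReal_inv, smul_eq_mul]
  change meanSize μ / ((μ.real (Ici m))⁻¹ * _) = _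
  rw [mul_comm, ← div_div, div_div_eq_mul_div, div_inv_eq_mul, mul_comm (meanSize μ) 2,
    mul_div_cancel_right₀ _ hE.ne']

/-- A majority of the jobs is small. -/
lemma measureReal_Ici_le_Iio (hpos : μ (Iio 0) = 0) (hsq : Integrable (fun s : ℝ => s ^ 2) μ)
    {m : ℝ} (hm : ∫ s in Iio m, s ∂μ = meanSize μ / 2) : μ.real (Ici m) ≤ μ.real (Iio m) := by
  have hE := meanSize_pos hpos hsq
  have hi := integrable_of_sq hsq
  have h1 : ∫ s in Ici m, s ∂μ = meanSize μ / 2 := by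
    rw [setIntegral_Ici_eq_sub hi, hm, meanSize]
    ring
  -- The two equal halves of the load are compared with `m`: `m P(S ≥ m) ≤ E[S] / 2 ≤ m P(S < m)`.
  have hlow : ∫ s in Iio m, s ∂μ ≤ μ.real (Iio m) * m := by
    have := setIntegral_mono_on hi.integrableOn (integrable_const m).integrableOn
      measurableSet_Iio (fun s hs => le_of_lt (mem_Iio.1 hs))
    simpa using this
  have hhigh : μ.real (Ici m) * m ≤ ∫ s in Ici m, s ∂μ := by
    have := setIntegral_mono_on (integrable_const m).integrableOn hi.integrableOn
      measurableSet_Ici (fun s hs => mem_Ici.1 hs)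
    simpa using this
  have hm0 : 0 < m := by
    by_contra! h
    have h2 : μ (Iio m) = 0 := measure_mono_null (Iio_subset_Iio h) hpos
    rw [Measure.restrict_eq_zero.2 h2, integral_zero_measure] at hm
    linarith
  exact le_of_mul_le_mul_right (by linarith) hm0

/-- Comparison of the constants of SITA with optimal thresholds and of CARD. -/
theorem kCard_mul_le_sitaConst (hpos : μ (Iio 0) = 0) (hsq : Integrable (fun s : ℝ => s ^ 2) μ)
    {m : ℝ} (hm : ∫ s in Iio m, s ∂μ = meanSize μ / 2) :
    kCard μ m *
        (1 + 2 * √((∫ s in Iio m, s ^ 2 ∂μ) * ∫ s in Ici m, s ^ 2 ∂μ) / ∫ s, s ^ 2 ∂μ) ≤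
        sitaConst μ m ∧ kCard μ m < sitaConst μ m := by
  have hE := meanSize_pos hpos hsq
  have hM := integral_sq_pos hpos hsq
  have hA0 : μ (Iio m) ≠ 0 := fun h => by
    rw [Measure.restrict_eq_zero.2 h, integral_zero_measure] at hm
    linarith
  have hA1 : μ (Ici m) ≠ 0 := fun h => by
    have h1 := setIntegral_Ici_eq_sub (integrable_of_sq hsq) m
    rw [Measure.restrict_eq_zero.2 h, integral_zero_measure, hm, meanSize] at h1
    rw [meanSize] at hE
    linarith
  have hQ0 := setIntegral_pow_pos hpos hsq hA0
  have hQ1 := setIntegral_pow_pos hpos hsq hA1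
  have hp1 : 0 < μ.real (Ici m) := ENNReal.toReal_pos hA1 (measure_ne_top _ _)
  have hp := measureReal_Ici_le_Iio hpos hsq hm
  have hsum := setIntegral_Ici_eq_sub hsq m
  have hr : 0 < √((∫ s in Iio m, s ^ 2 ∂μ) * ∫ s in Ici m, s ^ 2 ∂μ) :=
    Real.sqrt_pos.2 (mul_pos hQ0 hQ1)
  -- The cross term of the square contains the geometric mean of the two probabilities, which is at
  -- least the smaller one, `P(S ≥ m)`.
  have hcross : μ.real (Ici m) * √((∫ s in Iio m, s ^ 2 ∂μ) * ∫ s in Ici m, s ^ 2 ∂μ) ≤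
      splitRoot μ (Iio m) * splitRoot μ (Ici m) := by
    rw [splitRoot, splitRoot, ← Real.sqrt_mul (by positivity)]
    refine Real.le_sqrt_of_sq_le ?_
    rw [mul_pow, Real.sq_sqrt (by positivity)]
    nlinarith [mul_le_mul_of_nonneg_right hp (by positivity :
      0 ≤ μ.real (Ici m) * ((∫ s in Iio m, s ^ 2 ∂μ) * ∫ s in Ici m, s ^ 2 ∂μ))]
  have hle : kCard μ m *
      (1 + 2 * √((∫ s in Iio m, s ^ 2 ∂μ) * ∫ s in Ici m, s ^ 2 ∂μ) / ∫ s, s ^ 2 ∂μ) ≤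
      sitaConst μ m := by
    rw [kCard_eq hpos hsq hm, sitaConst, add_sq, sq_splitRoot, sq_splitRoot, one_add_div hM.ne',
      ← mul_div_assoc, div_mul_eq_mul_div]
    refine div_le_div_of_nonneg_right ?_ hM.le
    nlinarith [mul_le_mul_of_nonneg_right hp hQ0.le]
  refine ⟨hle, lt_of_lt_of_le ?_ hle⟩
  rw [kCard_eq hpos hsq hm]
  exact lt_mul_of_one_lt_right (by positivity) (lt_add_of_pos_right _ (by positivity))

end Dispatch

theorem mainTheorem6 (μ : Measure ℝ) [IsProbabilityMeasure μ] [NullSingletonClass μ]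
    (hpos : μ (Iio 0) = 0) (hsq : Integrable (fun s : ℝ => s ^ 2) μ)
    (m : ℝ) (hm : ∫ s in Iio m, s ∂μ = (1 - 1 / 2) * Dispatch.meanSize μ) :
    -- for `0 < ε < 1 / 2` the long-run averages in the definitions are limits, the M/G/1 has its
    -- well-known mean work, and an optimal threshold for SITA exists
    (∀ ε ∈ Ioo (0 : ℝ) (1 / 2),
      (∀ θ : ℝ,
        Tendsto (Dispatch.avgResponseTime μ (Dispatch.arrivalRate μ ε) (Dispatch.sita θ)) atTop
          (𝓝 (Dispatch.meanResponseTime μ (Dispatch.arrivalRate μ ε) (Dispatch.sita θ)))) ∧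
      Tendsto (Dispatch.avgWork μ (Dispatch.arrivalRate μ ε) Dispatch.pooled) atTop
        (𝓝 (ENNReal.ofReal (Dispatch.arrivalRate μ ε * (∫ s, s ^ 2 ∂μ) / (2 * ε)))) ∧
      ∃ θ : ℝ, Dispatch.meanResponseTime μ (Dispatch.arrivalRate μ ε) (Dispatch.sita θ) =
        Dispatch.sitaOResponseTime μ (Dispatch.arrivalRate μ ε)) ∧
    ∃ K : ℝ,
      Dispatch.IsHeavyTrafficConstant μ (Dispatch.sitaOResponseTime μ) (ENNReal.ofReal K) ∧
      K = 2 / (∫ s, s ^ 2 ∂μ) *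
        (√((∫ s in Iio m, s ^ 2 ∂μ) * μ.real (Iio m)) +
          √((∫ s in Ici m, s ^ 2 ∂μ) * μ.real (Ici m))) ^ 2 ∧
      Dispatch.kCard μ m *
        (1 + 2 * √((∫ s in Iio m, s ^ 2 ∂μ) * ∫ s in Ici m, s ^ 2 ∂μ) / ∫ s, s ^ 2 ∂μ) ≤ K ∧
      Dispatch.kCard μ m < K := by
  have hE := Dispatch.meanSize_pos hpos hsq
  have hm' : ∫ s in Iio m, s ∂μ = Dispatch.meanSize μ / 2 := by
    rw [hm]
    ring
  refine ⟨fun ε hε => ⟨fun θ => ?_, Dispatch.tendsto_avgWork_arrivalRate hpos hsq hε, ?_⟩,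
    Dispatch.sitaConst μ m, Dispatch.isHeavyTrafficConstant_sitaO hpos hsq hm', rfl,
    Dispatch.kCard_mul_le_sitaConst hpos hsq hm'⟩
  · have hlam := Dispatch.arrivalRate_pos hE hε
    rw [Dispatch.meanResponseTime_sita hlam hpos hsq]
    exact Dispatch.tendsto_avgResponseTime_sita hlam hpos hsq θ
  · have hlam := Dispatch.arrivalRate_pos hE hε
    -- `ε < 1/2` enters here: a single server facing all jobs would have load `2(1 - ε) > 1`.
    obtain ⟨θ, hθ⟩ := Dispatch.exists_sitaCost_le hlam hpos hsq (by
      rw [mul_assoc, Dispatch.arrivalRate_mul_meanSize hE]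
      linarith [hε.2])
    refine ⟨θ, le_antisymm (le_iInf fun θ' => ?_) (iInf_le _ _)⟩
    rw [Dispatch.meanResponseTime_sita hlam hpos hsq, Dispatch.meanResponseTime_sita hlam hpos hsq]
    exact hθ θ'
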